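/- **Theorem.** Let $D\ge 1$, let $\mathcal X\subset\mathbb R^D$ be compact and let $f:\mathcal X\to\mathbb R$ be continuous. Let $p_X$ be a probability density on $\mathbb R^D$ that vanishes outside $\mathcal X$, with $p_{X,0}:=\inf_{x\in\mathcal X}p_X(x)>0$. Let $\gamma,r_0>0$ be such that $\mathrm{Vol}(\mathcal X\cap \bar B(x,r))\ge\gamma\,\mathrm{Vol}(\bar B(x,r))$ for all $x\in\mathcal X$ and $0<r<r_0$, where $\bar B(x,r)$ is the closed Euclidean ball. Let $\xi$ be a real random variable with $\mathbb E\,\xi=0$ and $\mathbb E\,e^{t\xi}\le e^{\sigma^2t^2/2}$ for all $t\in\mathbb R$, where $\sigma\ge 0$. Let $x_1,\dots,x_n$ be i.i.d. with density $p_X$, let $\xi_1,\dots,\xi_n$ be i.i.d. copies of $\xi$ independent of the $x_i$, and put $y_i=f(x_i)+\xi_i$. For $1\le k\le n$ let $r_k(x)=\inf\{r:\#\{i:|x-x_i|\le r\}\ge k\}$, $N_k(x)=\{i:|x-x_i|\le r_k(x)\}$ and $f_k(x)=|N_k(x)|^{-1}\sum_{i\in N_k(x)}y_i$. Let $\hat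 x$ be any maximizer of $f_k$ among the sample points $x_1,\dots,x_n$, and let $v_D$ be the volume of the unit ball of $\mathbb R^D$. Suppose that $f$ has a unique maximizer $x_0$ on $\mathcal X$, that $x_0$ is an interior point of $\mathcal X$, and that $f$ is twice differentiable at $x_0$ with negative-definite Hessian there. Then the following hold. (1) There are $\hat C,\check C,r_M>0$ and $\lambda\in\mathbb R$ such that, with $A_0$ the connected component of $\{x\in\mathcal X:f(x)\ge\lambda\}$ that contains $x_0$, $$\check C|x_0-x|^2\le f(x_0)-f(x)\le\hat C|x_0-x|^2\quad\text{for all }x\in A_0,\qquad \bar B(x_0,r_M)\subseteq A_0,$$ and $A_0$ contains every local maximizer $z$ of $f$ on $\mathcal X$ with $f(z)\ge\lambda$. (The last condition is automatic if $x_0$ is the only local maximizer of $f$ on $\mathcal X$.) (2) For all constants as in (1), all $\delta\in(0,1)$ and all integers $n,k$ with $k\ge1$ and $$k\ge 2^{10}D\log^2(4/\delta)\,\log n\cdot\max\Big\{1,\frac{\sigma^2}{\check C^2r_M^4}\Big\},\qquad k\le\tfrac12\,\gamma\,p_{X,0}\,v_D\min\Big\{r_0^D,\Big(\frac{\check C r_M^2}{32\hat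 C}\Big)^{D/2}\Big\}\,n,$$ with probability at least $1-\delta$, $$|\hat x-x_0|^2\le\max\Big\{\frac{32\sigma}{\check C}\sqrt{\frac{D\log n+\log(2/\delta)}{k}},\ \frac{32\hat C}{\check C}\Big(\frac{2k}{\gamma\,p_{X,0}\,v_D\,n}\Big)^{2/D}\Big\}.$$ (3) If $k=k_n$ is of exact order $n^{4/(4+D)}$, there is a constant $C>0$ such that for every $\delta\in(0,1)$ and all sufficiently large $n$ (depending on $\delta$), with probability at least $1-\delta$, $|\hat x-x_0|\le C(\log n)^{1/4}n^{-1/(4+D)}$. Thus $|\hat x-x_0|=\tilde O(n^{-1/(4+D)})$. -/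

import Mathlib

open MeasureTheory ProbabilityTheory Filter Topology
open scoped NNReal ENNReal

noncomputable section

/-- `D`-dimensional Euclidean space. -/
abbrev Euc (D : ℕ) : Type := EuclideanSpace ℝ (Fin D)

/-- Volume `v_D` of the unit ball of `ℝ^D`. -/
def unitBallVolume (D : ℕ) : ℝ := (volume : Measure (Euc D)).real (Metric.closedBall 0 1)

/-- Support regularity with constants `γ` and `r₀`: balls centred in `𝒳` of radius less than `r₀`
keep at least the fraction `γ` of their volume inside `𝒳`. -/
def SupportRegular {D : ℕ} (𝒳 : Set (Euc D)) (γ r₀ : ℝ) : Prop :=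
  ∀ x ∈ 𝒳, ∀ r : ℝ, 0 < r → r < r₀ →
    γ * (volume : Measure (Euc D)).real (Metric.closedBall x r) ≤
      (volume : Measure (Euc D)).real (𝒳 ∩ Metric.closedBall x r)

/-- `p` is a probability density with respect to Lebesgue measure that vanishes off `𝒳`. -/
structure IsDensityOn {D : ℕ} (p : Euc D → ℝ) (𝒳 : Set (Euc D)) : Prop where
  measurable : Measurable p
  nonneg : ∀ x, 0 ≤ p x
  eq_zero : ∀ x, x ∉ 𝒳 → p x = 0
  total : ∫⁻ x, ENNReal.ofReal (p x) = 1

/-- The infimum of the density over `𝒳`. -/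
def densityInf {D : ℕ} (p : Euc D → ℝ) (𝒳 : Set (Euc D)) : ℝ := sInf (p '' 𝒳)

/-- Joint law of `n` i.i.d. pairs (design point, noise), the design point having density `p`, and
the noise having law `ν` and being independent of the design point. -/
def sampleLaw {D : ℕ} (p : Euc D → ℝ) (ν : Measure ℝ) (n : ℕ) :
    Measure (Fin n → Euc D × ℝ) :=
  Measure.pi fun _ => ((volume : Measure (Euc D)).withDensity fun x => ENNReal.ofReal (p x)).prod ν

/-- The observation `y_i = f (x_i) + ξ_i`. -/
def response {D n : ℕ} (f : Euc D → ℝ) (s : Fin n → Euc D × ℝ) (i : Fin n) : ℝ :=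
  f (s i).1 + (s i).2

open Classical in
/-- Indices of the sample points in the closed ball of radius `r` about `x`. -/
def pointsIn {D n : ℕ} (s : Fin n → Euc D × ℝ) (x : Euc D) (r : ℝ) : Finset (Fin n) :=
  Finset.univ.filter fun i => dist x (s i).1 ≤ r

/-- The `k`-NN radius `r_k(x)`. -/
def knnRadius {D n : ℕ} (s : Fin n → Euc D × ℝ) (k : ℕ) (x : Euc D) : ℝ :=
  sInf {r : ℝ | k ≤ (pointsIn s x r).card}

/-- The `k`-NN set `N_k(x)`, as a set of sample indices. -/
def knnSet {D n : ℕ} (s : Fin n → Euc D × ℝ) (k : ℕ) (x : Euc D) : Finset (Fin n) :=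
  pointsIn s x (knnRadius s k x)

/-- The `k`-NN regression function `f_k`. -/
def knnRegression {D n : ℕ} (f : Euc D → ℝ) (s : Fin n → Euc D × ℝ) (k : ℕ) (x : Euc D) : ℝ :=
  ((knnSet s k x).card : ℝ)⁻¹ * ∑ i ∈ knnSet s k x, response f s i

/-- `x` is a sample point at which `f_k` is maximal among the sample points. -/
def IsSampleArgmax {D n : ℕ} (f : Euc D → ℝ) (s : Fin n → Euc D × ℝ) (k : ℕ) (x : Euc D) : Prop :=
  (∃ i, x = (s i).1) ∧ ∀ j, knnRegression f s k (s j).1 ≤ knnRegression f s k x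

/-- `f` is twice differentiable at `x`, and its Hessian there is negative definite. -/
structure HasNegDefHessianAt {D : ℕ} (f : Euc D → ℝ) (x : Euc D) : Prop where
  differentiable_near : ∀ᶠ y in 𝓝 x, DifferentiableAt ℝ f y
  differentiable_fderiv : DifferentiableAt ℝ (fderiv ℝ f) x
  neg_def : ∀ v : Euc D, v ≠ 0 → fderiv ℝ (fderiv ℝ f) x v v < 0

/-- `x₀` is an interior point of `𝒳`, the unique maximizer of `f` on `𝒳`, and `f` has a
negative-definite Hessian at `x₀`. -/
structure IsNondegenerateMax {D : ℕ} (𝒳 : Set (Euc D)) (f : Euc D → ℝ) (x₀ : Euc D) : Prop where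
  mem_interior : x₀ ∈ interior 𝒳
  lt_max : ∀ x ∈ 𝒳, x ≠ x₀ → f x < f x₀
  hessian : HasNegDefHessianAt f x₀

/-- The connected component `A₀` of the superlevel set `{x ∈ 𝒳 : f x ≥ lam}` that contains `x₀`. -/
def peakComponent {D : ℕ} (𝒳 : Set (Euc D)) (f : Euc D → ℝ) (x₀ : Euc D) (lam : ℝ) :
    Set (Euc D) :=
  connectedComponentIn {x | x ∈ 𝒳 ∧ lam ≤ f x} x₀

/-- Constants of quadratic smoothness and decay of `f` around `x₀`. The last field says that `f`
has no further local maximizer at the levels `≥ lam`; it is automatic when `x₀` is the only local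
maximizer of `f` on `𝒳`. -/
structure QuadraticPeak {D : ℕ} (𝒳 : Set (Euc D)) (f : Euc D → ℝ) (x₀ : Euc D)
    (Chat Ccheck rM lam : ℝ) : Prop where
  Chat_pos : 0 < Chat
  Ccheck_pos : 0 < Ccheck
  rM_pos : 0 < rM
  ball_subset : Metric.closedBall x₀ rM ⊆ peakComponent 𝒳 f x₀ lam
  decay : ∀ x ∈ peakComponent 𝒳 f x₀ lam, Ccheck * ‖x₀ - x‖ ^ 2 ≤ f x₀ - f x
  smooth : ∀ x ∈ peakComponent 𝒳 f x₀ lam, f x₀ - f x ≤ Chat * ‖x₀ - x‖ ^ 2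
  only_peak : ∀ z ∈ 𝒳, lam ≤ f z → IsLocalMaxOn f 𝒳 z → z ∈ peakComponent 𝒳 f x₀ lam

/-- The property `S` holds with `μ`-probability at least `q`. -/
def WithProbAtLeast {Ω : Type*} [MeasurableSpace Ω] (μ : Measure Ω) (q : ℝ) (S : Ω → Prop) : Prop :=
  ∃ E : Set Ω, MeasurableSet E ∧ ENNReal.ofReal q ≤ μ E ∧ ∀ ω ∈ E, S ω

end

/-! On a good event the estimate is deterministic. Suppose that every sample point has at least `k`
sample points within distance `r`, that some sample point `x_i` lies within `r` of `x₀`, and that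
every noise average over neighbours is at most `t` in absolute value. The neighbours of `x_i` are
within `2r` of `x₀`, so `f_k(x_i) ≥ f x₀ - 4 Chat r² - t`. The sample maximizer does at least as
well, so after its own noise is removed one of its neighbours has `f ≥ f x₀ - 4 Chat r² - 2t`. This
level is above `lam`, and the superlevel set is connected: a clopen piece away from `x₀` would carry
another local maximizer (`QuadraticPeak.mem_peakComponent`). Quadratic decay therefore bounds the
distance of that neighbour from `x₀`, and the maximizer is at most `r` away from it
(`sq_norm_sub_le_of_isSampleArgmax`).

The good event is likely (`withProbAtLeast_good_event`). The radius `r` is chosen so that balls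
centred in the support have mass at least `2k/n`, and a Chernoff bound makes fewer than `k` points
in one of them improbable. Once the design is fixed, so are the neighbour sets, and the noise
averages are sub-Gaussian averages of at least `k` terms. Only the `n` sample points serve as
centres of averages, so a union bound suffices.

The two errors in `|xhat - x₀|²` are of order `√(log n / k)` and `(k/n)^(2/D)`; `k ~ n^(4/(4+D))`
balances them at `n^(-2/(4+D))` up to the logarithm. The constants exist because the Hessian
controls `f` near `x₀`, while compactness and uniqueness keep `f` strictly below `f x₀` elsewhere.
-/

/-! ### Geometry of the superlevel set around a nondegenerate maximum -/

section Peak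

variable {D : ℕ} {𝒳 : Set (Euc D)} {f : Euc D → ℝ} {x₀ : Euc D}

/-- If a component of a compact superlevel set contains all local maximizers at its levels, then it
is the whole superlevel set. -/
theorem QuadraticPeak.mem_peakComponent {Chat Ccheck rM lam : ℝ}
    (h : QuadraticPeak 𝒳 f x₀ Chat Ccheck rM lam) (h𝒳 : IsCompact 𝒳) (hf : ContinuousOn f 𝒳)
    {y : Euc D} (hy : y ∈ 𝒳) (hfy : lam ≤ f y) : y ∈ peakComponent 𝒳 f x₀ lam := by
  set L : Set (Euc D) := {x | x ∈ 𝒳 ∧ lam ≤ f x} with hL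
  have hLc : IsCompact L := by
    have h1 : IsClosed (𝒳 ∩ f ⁻¹' Set.Ici lam) :=
      hf.preimage_isClosed_of_isClosed h𝒳.isClosed isClosed_Ici
    exact h𝒳.of_isClosed_subset h1 (fun x hx => hx.1)
  have hx₀ : x₀ ∈ L := connectedComponentIn_subset L x₀
    (h.ball_subset (Metric.mem_closedBall_self h.rM_pos.le))
  have hcomp : peakComponent 𝒳 f x₀ lam
      = Subtype.val '' connectedComponent (⟨x₀, hx₀⟩ : L) := connectedComponentIn_eq_image hx₀
  have : CompactSpace L := isCompact_iff_compactSpace.mp hLc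
  by_contra hyn
  have hyn' : (⟨y, hy, hfy⟩ : L) ∉ connectedComponent (⟨x₀, hx₀⟩ : L) := by
    intro hmem
    exact hyn (hcomp ▸ ⟨_, hmem, rfl⟩)
  -- In a compact Hausdorff space components are intersections of clopen sets, so some clopen set
  -- separates `y` from `x₀`.
  have hsub : ∃ s : Set L, IsClopen s ∧ (⟨x₀, hx₀⟩ : L) ∈ s ∧ (⟨y, hy, hfy⟩ : L) ∉ s := by
    rw [connectedComponent_eq_iInter_isClopen, Set.mem_iInter] at hyn'
    push Not at hyn'
    obtain ⟨⟨s, hs, hxs⟩, hys⟩ := hyn'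
    exact ⟨s, hs, hxs, hys⟩
  obtain ⟨s, hs, hxs, hys⟩ := hsub
  have hfL : Continuous fun x : L => f x :=
    continuousOn_iff_continuous_domRestrict.mp (hf.mono fun x hx => hx.1)
  -- The maximizer `z` on the piece containing `y` is a local maximizer on all of `𝒳`: the piece is
  -- open in `L`, and off `L` values are below `lam`. So `only_peak` puts `z` in the component of
  -- `x₀`, on the other side of the separation.
  obtain ⟨z, hzs, hz⟩ := hs.compl.isClosed.isCompact.exists_isMaxOn ⟨_, hys⟩ hfL.continuousOn
  obtain ⟨V, hV, hVs⟩ := isOpen_induced_iff.mp hs.compl.isOpen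
  have hzV : (z : Euc D) ∈ V := by
    have : z ∈ Subtype.val ⁻¹' V := hVs ▸ hzs
    exact this
  have hloc : IsLocalMaxOn f 𝒳 z := by
    filter_upwards [mem_nhdsWithin_of_mem_nhds (hV.mem_nhds hzV), self_mem_nhdsWithin]
      with w hwV hw
    by_cases hlw : lam ≤ f w
    · have hws : (⟨w, hw, hlw⟩ : L) ∈ sᶜ := by
        rw [← hVs]
        exact hwV
      exact hz hws
    · exact (not_le.mp hlw).le.trans z.2.2
  have hzA := h.only_peak z z.2.1 z.2.2 hloc
  rw [hcomp] at hzA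
  obtain ⟨z', hz', hzz⟩ := hzA
  have : z' = z := Subtype.ext hzz
  subst this
  exact hzs (hs.connectedComponent_subset hxs hz')

/-- Compare decay with the level `lam` at a point at distance exactly `rM` from `x₀`; such a point
exists because `1 ≤ D`. -/
theorem QuadraticPeak.lam_le {Chat Ccheck rM lam : ℝ} (hD : 1 ≤ D)
    (h : QuadraticPeak 𝒳 f x₀ Chat Ccheck rM lam) : lam ≤ f x₀ - Ccheck * rM ^ 2 := by
  have : Nonempty (Fin D) := ⟨⟨0, hD⟩⟩
  obtain ⟨v, hv⟩ := exists_norm_eq (Euc D) h.rM_pos.le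
  have hmem : x₀ + v ∈ peakComponent 𝒳 f x₀ lam := h.ball_subset (by simp [hv])
  have h1 := h.decay _ hmem
  have h2 : lam ≤ f (x₀ + v) :=
    (connectedComponentIn_subset {x | x ∈ 𝒳 ∧ lam ≤ f x} x₀ hmem).2
  rw [sub_add_cancel_left, norm_neg, hv] at h1
  linarith

theorem QuadraticPeak.Ccheck_le_Chat {Chat Ccheck rM lam : ℝ} (hD : 1 ≤ D)
    (h : QuadraticPeak 𝒳 f x₀ Chat Ccheck rM lam) : Ccheck ≤ Chat := by
  have : Nonempty (Fin D) := ⟨⟨0, hD⟩⟩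
  obtain ⟨v, hv⟩ := exists_norm_eq (Euc D) h.rM_pos.le
  have hmem : x₀ + v ∈ peakComponent 𝒳 f x₀ lam := h.ball_subset (by simp [hv])
  have h1 := (h.decay _ hmem).trans (h.smooth _ hmem)
  rw [sub_add_cancel_left, norm_neg, hv] at h1
  exact le_of_mul_le_mul_right h1 (pow_pos h.rM_pos 2)

/-- The quadratic form attains a negative maximum on the compact unit sphere, and homogeneity
extends the bound to all vectors. -/
theorem exists_neg_bound_of_neg_def (H : Euc D →L[ℝ] Euc D →L[ℝ] ℝ)
    (hH : ∀ v, v ≠ 0 → H v v < 0) : ∃ m > 0, ∀ v, H v v ≤ -m * ‖v‖ ^ 2 := by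
  have hcont : Continuous fun v => H v v := by fun_prop
  -- The sphere is empty only for `D = 0`.
  rcases (Metric.sphere (0 : Euc D) 1).eq_empty_or_nonempty with he | hne
  · refine ⟨1, one_pos, fun v => ?_⟩
    by_cases hv : v = 0
    · simp [hv]
    · have : ‖v‖⁻¹ • v ∈ Metric.sphere (0 : Euc D) 1 := by
        simp [norm_smul, hv]
      simp [he] at this
  · obtain ⟨w, hw, hmax⟩ := (isCompact_sphere (0 : Euc D) 1).exists_isMaxOn hne hcont.continuousOn
    have hw0 : w ≠ 0 := by
      rintro rfl
      simp at hw
    refine ⟨-H w w, neg_pos.mpr (hH w hw0), fun v => ?_⟩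
    by_cases hv : v = 0
    · simp [hv]
    · have hmem : ‖v‖⁻¹ • v ∈ Metric.sphere (0 : Euc D) 1 := by
        simp [norm_smul, hv]
      have h1 : H (‖v‖⁻¹ • v) (‖v‖⁻¹ • v) ≤ H w w := hmax hmem
      have h2 : H (‖v‖⁻¹ • v) (‖v‖⁻¹ • v) = (‖v‖ ^ 2)⁻¹ * H v v := by
        simp only [map_smul, _root_.smul_apply, smul_eq_mul]
        ring
      have hpos : 0 < ‖v‖ ^ 2 := by positivity
      rw [h2, inv_mul_le_iff₀ hpos] at h1
      linarith

/-- Second-order behaviour of a function at a critical point with negative-definite Hessian. -/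
theorem HasNegDefHessianAt.exists_quadratic_bounds (h : HasNegDefHessianAt f x₀)
    (h0 : fderiv ℝ f x₀ = 0) : ∃ c > 0, ∃ C > 0, ∃ ρ > 0, ∀ v : Euc D, ‖v‖ < ρ →
      DifferentiableAt ℝ f (x₀ + v) ∧ c * ‖v‖ ^ 2 ≤ f x₀ - f (x₀ + v) ∧
      f x₀ - f (x₀ + v) ≤ C * ‖v‖ ^ 2 ∧ (v ≠ 0 → fderiv ℝ f (x₀ + v) v < 0) := by
  set H := fderiv ℝ (fderiv ℝ f) x₀ with hHdef
  obtain ⟨m, hm, hneg⟩ := exists_neg_bound_of_neg_def H h.neg_def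
  have hlo := (h.differentiable_fderiv.hasFDerivAt.isLittleO).def (half_pos hm)
  obtain ⟨ρ, hρ, hball⟩ := Metric.eventually_nhds_iff_ball.mp (hlo.and h.differentiable_near)
  have key : ∀ v : Euc D, ‖v‖ < ρ → DifferentiableAt ℝ f (x₀ + v) ∧
      ‖fderiv ℝ f (x₀ + v) - H v‖ ≤ m / 2 * ‖v‖ := by
    intro v hv
    have := hball (x₀ + v) (by simpa using hv)
    refine ⟨this.2, ?_⟩
    simpa [h0] using this.1
  refine ⟨m / 4, by positivity, (‖H‖ + m / 2) / 2, by positivity, ρ, hρ, fun v hv => ?_⟩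
  have hseg : ∀ t ∈ Set.Icc (0 : ℝ) 1, ‖t • v‖ < ρ := by
    intro t ht
    rw [norm_smul, Real.norm_of_nonneg ht.1]
    exact (mul_le_of_le_one_left (norm_nonneg _) ht.2).trans_lt hv
  have hder : ∀ t ∈ Set.Icc (0 : ℝ) 1,
      HasDerivAt (fun t : ℝ => f (x₀ + t • v)) (fderiv ℝ f (x₀ + t • v) v) t := by
    intro t ht
    have h1 : HasDerivAt (fun t : ℝ => x₀ + t • v) v t := by
      simpa using ((hasDerivAt_id t).smul_const v).const_add x₀
    exact ((key _ (hseg t ht)).1.hasFDerivAt).comp_hasDerivAt t h1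
  have hclose : ∀ t ∈ Set.Icc (0 : ℝ) 1,
      |fderiv ℝ f (x₀ + t • v) v - t * H v v| ≤ m / 2 * t * ‖v‖ ^ 2 := by
    intro t ht
    have h1 := (key _ (hseg t ht)).2
    have h2 := (fderiv ℝ f (x₀ + t • v) - H (t • v)).le_opNorm v
    have h3 : (fderiv ℝ f (x₀ + t • v) - H (t • v)) v = fderiv ℝ f (x₀ + t • v) v - t * H v v := by
      simp
    rw [h3, Real.norm_eq_abs] at h2
    rw [norm_smul, Real.norm_of_nonneg ht.1] at h1
    calc _ ≤ _ := h2
      _ ≤ (m / 2 * (t * ‖v‖)) * ‖v‖ := by gcongr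
      _ = _ := by ring
  have hHv : |H v v| ≤ ‖H‖ * ‖v‖ ^ 2 := by
    have := H.le_opNorm₂ v v
    rw [Real.norm_eq_abs] at this
    linarith
  -- `fderiv ℝ f` is differentiable only at `x₀`, so the mean value theorem is applied to `f (x₀ + t
  -- • v) + a t²`. Its derivative is `t (H v v + 2a)` up to `m/2 * t * ‖v‖²`; the two choices of `a`
  -- below give it a definite sign.
  have mvt : ∀ a : ℝ, ∃ t ∈ Set.Ioo (0 : ℝ) 1,
      f (x₀ + v) + a - f x₀ = fderiv ℝ f (x₀ + t • v) v + 2 * a * t := by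
    intro a
    have hd : ∀ t ∈ Set.Icc (0 : ℝ) 1, HasDerivAt (fun t : ℝ => f (x₀ + t • v) + a * t ^ 2)
        (fderiv ℝ f (x₀ + t • v) v + 2 * a * t) t := by
      intro t ht
      have h2 := (hder t ht).add ((hasDerivAt_pow 2 t).const_mul a)
      refine h2.congr_deriv ?_
      push_cast
      ring
    obtain ⟨t, ht, he⟩ := exists_hasDerivAt_eq_slope _ _ (zero_lt_one' ℝ)
      (fun t ht => (hd t ht).continuousAt.continuousWithinAt)
      (fun t ht => hd t (Set.Ioo_subset_Icc_self ht))
    refine ⟨t, ht, ?_⟩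
    rw [he]
    simp
  refine ⟨(key v hv).1, ?_, ?_, ?_⟩
  · obtain ⟨t, ht, he⟩ := mvt (m / 4 * ‖v‖ ^ 2)
    have h1 := (abs_le.mp (hclose t ⟨ht.1.le, ht.2.le⟩)).2
    have h2 := mul_le_mul_of_nonneg_left (hneg v) ht.1.le
    nlinarith
  · obtain ⟨t, ht, he⟩ := mvt ((‖H‖ + m / 2) / 2 * ‖v‖ ^ 2)
    have h1 := (abs_le.mp (hclose t ⟨ht.1.le, ht.2.le⟩)).1
    have h2 := mul_le_mul_of_nonneg_left (abs_le.mp hHv).1 ht.1.le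
    nlinarith
  · intro hv0
    have h1 := (abs_le.mp (hclose 1 (by simp))).2
    rw [one_smul, one_mul, mul_one] at h1
    have h2 := hneg v
    have : 0 < m * ‖v‖ ^ 2 := by positivity
    linarith

theorem IsNondegenerateMax.exists_quadraticPeak (h𝒳 : IsCompact 𝒳) (hf : ContinuousOn f 𝒳)
    (h : IsNondegenerateMax 𝒳 f x₀) :
    ∃ Chat Ccheck rM lam : ℝ, QuadraticPeak 𝒳 f x₀ Chat Ccheck rM lam := by
  have hx₀ : x₀ ∈ 𝒳 := interior_subset h.mem_interior
  have hle : ∀ x ∈ 𝒳, f x ≤ f x₀ := fun x hx => by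
    by_cases hxx : x = x₀
    · rw [hxx]
    · exact (h.lt_max x hx hxx).le
  have h0 : fderiv ℝ f x₀ = 0 := by
    refine IsLocalMax.fderiv_eq_zero ?_
    filter_upwards [mem_interior_iff_mem_nhds.mp h.mem_interior] with x hx
    exact hle x hx
  obtain ⟨c, hc, C, hC, ρ₁, hρ₁, hq⟩ := h.hessian.exists_quadratic_bounds h0
  obtain ⟨ρ₂, hρ₂, hball⟩ := Metric.isOpen_iff.mp isOpen_interior _ h.mem_interior
  set ρ := min ρ₁ ρ₂ with hρdef
  have hρ : 0 < ρ := lt_min hρ₁ hρ₂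
  have hq' : ∀ x, x ∈ Metric.ball x₀ ρ → DifferentiableAt ℝ f x ∧
      c * ‖x₀ - x‖ ^ 2 ≤ f x₀ - f x ∧ f x₀ - f x ≤ C * ‖x₀ - x‖ ^ 2 ∧
      (x ≠ x₀ → fderiv ℝ f x ≠ 0) := by
    intro x hx
    have hx' : ‖x - x₀‖ < ρ₁ := (mem_ball_iff_norm.mp hx).trans_le (min_le_left _ _)
    obtain ⟨h1, h2, h3, h4⟩ := hq (x - x₀) hx'
    rw [add_sub_cancel] at h1 h2 h3 h4
    rw [norm_sub_rev]
    refine ⟨h1, h2, h3, fun hne hz => ?_⟩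
    have := h4 (sub_ne_zero.mpr hne)
    simp [hz] at this
  have hint : Metric.ball x₀ ρ ⊆ interior 𝒳 :=
    (Metric.ball_subset_ball (min_le_right _ _)).trans hball
  -- `lam` is halfway between `f x₀` and the maximum of `f` off the ball, so the superlevel set
  -- stays inside the ball.
  obtain ⟨lam, hlam, hsup⟩ : ∃ lam < f x₀, ∀ x ∈ 𝒳, lam ≤ f x → x ∈ Metric.ball x₀ ρ := by
    rcases (𝒳 \ Metric.ball x₀ ρ).eq_empty_or_nonempty with he | hne
    · exact ⟨f x₀ - 1, by linarith, fun x hx _ => Set.sdiff_eq_empty.mp he hx⟩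
    · obtain ⟨w, hw, hmax⟩ := (h𝒳.diff Metric.isOpen_ball).exists_isMaxOn hne
        (hf.mono Set.sdiff_subset)
      have hwx : w ≠ x₀ := by
        rintro rfl
        exact hw.2 (Metric.mem_ball_self hρ)
      have hlt := h.lt_max w hw.1 hwx
      refine ⟨(f w + f x₀) / 2, by linarith, fun x hx hfx => ?_⟩
      by_contra hxn
      have : f x ≤ f w := hmax ⟨hx, hxn⟩
      linarith
  -- `ρ / 2` keeps the closed ball inside the open one; the square root makes `C * rM² ≤ f x₀ -
  -- lam`, so that `f ≥ lam` on it.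
  set rM := min (ρ / 2) (√((f x₀ - lam) / C)) with hrM
  have hgap : 0 < (f x₀ - lam) / C := div_pos (by linarith) hC
  have hrMpos : 0 < rM := lt_min (half_pos hρ) (Real.sqrt_pos.mpr hgap)
  have hcomp : ∀ x ∈ peakComponent 𝒳 f x₀ lam, x ∈ Metric.ball x₀ ρ := fun x hx => by
    have hm := connectedComponentIn_subset {x | x ∈ 𝒳 ∧ lam ≤ f x} x₀ hx
    exact hsup x hm.1 hm.2
  refine ⟨C, c, rM, lam, hC, hc, hrMpos, ?_, fun x hx => (hq' x (hcomp x hx)).2.1,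
    fun x hx => (hq' x (hcomp x hx)).2.2.1, ?_⟩
  · refine (convex_closedBall x₀ rM).isPreconnected.subset_connectedComponentIn
      (Metric.mem_closedBall_self hrMpos.le) fun x hx => ?_
    have hxρ : x ∈ Metric.ball x₀ ρ := by
      rw [Metric.mem_closedBall] at hx
      rw [Metric.mem_ball]
      have := min_le_left (ρ / 2) (√((f x₀ - lam) / C))
      linarith
    refine ⟨interior_subset (hint hxρ), ?_⟩
    have h1 := (hq' x hxρ).2.2.1
    have h2 : ‖x₀ - x‖ ≤ √((f x₀ - lam) / C) := by
      rw [Metric.mem_closedBall, dist_comm, dist_eq_norm] at hx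
      exact hx.trans (min_le_right _ _)
    have h3 : ‖x₀ - x‖ ^ 2 ≤ (f x₀ - lam) / C := by
      rw [← Real.sq_sqrt hgap.le]
      gcongr
    rw [le_div_iff₀ hC] at h3
    linarith
  · intro z hz hfz hloc
    have hzρ := hsup z hz hfz
    -- In the ball the gradient vanishes only at `x₀`.
    have hzx : z = x₀ := by
      by_contra hne
      refine (hq' z hzρ).2.2.2 hne (IsLocalMax.fderiv_eq_zero ?_)
      exact hloc.isLocalMax (mem_interior_iff_mem_nhds.mp (hint hzρ))
    rw [hzx]
    exact mem_connectedComponentIn ⟨hx₀, hlam.le⟩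

end Peak

/-! ### Nearest-neighbour sets, measurability, and the deterministic estimate -/

section NearestNeighbours

variable {D n : ℕ}

theorem mem_pointsIn {s : Fin n → Euc D × ℝ} {x : Euc D} {r : ℝ} {i : Fin n} :
    i ∈ pointsIn s x r ↔ dist x (s i).1 ≤ r := by
  simp [pointsIn]

theorem pointsIn_mono (s : Fin n → Euc D × ℝ) (x : Euc D) {r r' : ℝ} (h : r ≤ r') :
    pointsIn s x r ⊆ pointsIn s x r' := fun _ hi =>
  mem_pointsIn.mpr ((mem_pointsIn.mp hi).trans h)

theorem nonneg_of_le_card_pointsIn {s : Fin n → Euc D × ℝ} {x : Euc D} {k : ℕ} {r : ℝ}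
    (hk : 1 ≤ k) (h : k ≤ (pointsIn s x r).card) : 0 ≤ r := by
  obtain ⟨i, hi⟩ := Finset.card_pos.mp (hk.trans h)
  exact dist_nonneg.trans (mem_pointsIn.mp hi)

theorem bddBelow_knnRadius (s : Fin n → Euc D × ℝ) {k : ℕ} (hk : 1 ≤ k) (x : Euc D) :
    BddBelow {r : ℝ | k ≤ (pointsIn s x r).card} :=
  ⟨0, fun _ hr => nonneg_of_le_card_pointsIn hk hr⟩

/-- A finite union, over index sets of size at least `k`, of closed half-lines. Closedness makes the
infimum defining `knnRadius` attained. -/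
theorem isClosed_setOf_le_card_pointsIn (s : Fin n → Euc D × ℝ) (k : ℕ) (x : Euc D) :
    IsClosed {r : ℝ | k ≤ (pointsIn s x r).card} := by
  have h : {r : ℝ | k ≤ (pointsIn s x r).card}
      = ⋃ S ∈ {S : Finset (Fin n) | k ≤ S.card}, ⋂ i ∈ S, Set.Ici (dist x (s i).1) := by
    ext r
    simp only [Set.mem_ofPred_eq, Set.mem_iUnion, Set.mem_iInter, Set.mem_Ici, exists_prop]
    constructor
    · exact fun hr => ⟨_, hr, fun i hi => mem_pointsIn.mp hi⟩
    · rintro ⟨S, hS, hSr⟩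
      exact hS.trans (Finset.card_le_card fun i hi => mem_pointsIn.mpr (hSr i hi))
  rw [h]
  exact (Set.toFinite _).isClosed_biUnion fun S _ =>
    isClosed_biInter fun i _ => isClosed_Ici

theorem knnRadius_le {s : Fin n → Euc D × ℝ} {k : ℕ} (hk : 1 ≤ k) {x : Euc D} {r : ℝ}
    (h : k ≤ (pointsIn s x r).card) : knnRadius s k x ≤ r :=
  csInf_le (bddBelow_knnRadius s hk x) h

theorem nonempty_setOf_le_card_pointsIn (s : Fin n → Euc D × ℝ) {k : ℕ} (hkn : k ≤ n) (x : Euc D) :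
    {r : ℝ | k ≤ (pointsIn s x r).card}.Nonempty := by
  refine ⟨∑ i, dist x (s i).1, ?_⟩
  have : pointsIn s x (∑ i, dist x (s i).1) = Finset.univ := by
    ext i
    simp only [mem_pointsIn, Finset.mem_univ, iff_true]
    exact Finset.single_le_sum (f := fun i => dist x (s i).1) (fun _ _ => dist_nonneg)
      (Finset.mem_univ i)
  simpa [this] using hkn

theorem le_card_knnSet (s : Fin n → Euc D × ℝ) {k : ℕ} (hk : 1 ≤ k) (hkn : k ≤ n) (x : Euc D) :
    k ≤ (knnSet s k x).card :=
  (isClosed_setOf_le_card_pointsIn s k x).csInf_mem (nonempty_setOf_le_card_pointsIn s hkn x)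
    (bddBelow_knnRadius s hk x)

theorem knnRadius_le_iff (s : Fin n → Euc D × ℝ) {k : ℕ} (hk : 1 ≤ k) (hkn : k ≤ n) (x : Euc D)
    (r : ℝ) : knnRadius s k x ≤ r ↔ k ≤ (pointsIn s x r).card :=
  ⟨fun h => (le_card_knnSet s hk hkn x).trans (Finset.card_le_card (pointsIn_mono s x h)),
    knnRadius_le hk⟩

theorem dist_le_of_mem_knnSet {s : Fin n → Euc D × ℝ} {k : ℕ} (hk : 1 ≤ k) {x : Euc D} {r : ℝ}
    (h : k ≤ (pointsIn s x r).card) {i : Fin n} (hi : i ∈ knnSet s k x) : dist x (s i).1 ≤ r :=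
  (mem_pointsIn.mp hi).trans (knnRadius_le hk h)

/-- Neighbour sets ignore the noise, which is what allows conditioning on the design. -/
theorem knnSet_congr {s s' : Fin n → Euc D × ℝ} (h : ∀ i, (s i).1 = (s' i).1) (k : ℕ)
    (x : Euc D) : knnSet s k x = knnSet s' k x := by
  have h1 : ∀ r, pointsIn s x r = pointsIn s' x r := fun r => by
    ext i
    rw [mem_pointsIn, mem_pointsIn, h]
  simp only [knnSet, knnRadius, h1]

/-- The average of the noise over the `k` nearest neighbours of `x`. -/
noncomputable def noiseAverage (s : Fin n → Euc D × ℝ) (k : ℕ) (x : Euc D) : ℝ :=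
  ((knnSet s k x).card : ℝ)⁻¹ * ∑ i ∈ knnSet s k x, (s i).2

theorem knnRegression_eq (f : Euc D → ℝ) (s : Fin n → Euc D × ℝ) (k : ℕ) (x : Euc D) :
    knnRegression f s k x
      = ((knnSet s k x).card : ℝ)⁻¹ * ∑ i ∈ knnSet s k x, f (s i).1 + noiseAverage s k x := by
  simp only [knnRegression, noiseAverage, response, Finset.sum_add_distrib, mul_add]

theorem le_card_inv_mul_sum {S : Finset (Fin n)} (hS : 0 < S.card) {g : Fin n → ℝ} {b : ℝ}
    (h : ∀ i ∈ S, b ≤ g i) : b ≤ (S.card : ℝ)⁻¹ * ∑ i ∈ S, g i := by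
  have h1 := Finset.card_nsmul_le_sum S g b h
  rw [nsmul_eq_mul] at h1
  rwa [le_inv_mul_iff₀ (by exact_mod_cast hS)]

theorem measurableSet_le_card_pointsIn {k : ℕ} (j : Fin n) (r : ℝ) :
    MeasurableSet {s : Fin n → Euc D × ℝ | k ≤ (pointsIn s (s j).1 r).card} := by
  have h : {s : Fin n → Euc D × ℝ | k ≤ (pointsIn s (s j).1 r).card}
      = ⋃ S ∈ {S : Finset (Fin n) | k ≤ S.card},
        ⋂ i ∈ S, {s : Fin n → Euc D × ℝ | dist (s j).1 (s i).1 ≤ r} := by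
    ext s
    simp only [Set.mem_ofPred_eq, Set.mem_iUnion, Set.mem_iInter, exists_prop]
    constructor
    · exact fun hr => ⟨_, hr, fun i hi => mem_pointsIn.mp hi⟩
    · rintro ⟨S, hS, hSr⟩
      exact hS.trans (Finset.card_le_card fun i hi => mem_pointsIn.mpr (hSr i hi))
  rw [h]
  refine (Set.toFinite _).measurableSet_biUnion fun S _ =>
    S.measurableSet_biInter fun i _ => measurableSet_le ?_ measurable_const
  fun_prop

theorem measurable_knnRadius {k : ℕ} (hk : 1 ≤ k) (hkn : k ≤ n) (j : Fin n) :
    Measurable fun s : Fin n → Euc D × ℝ => knnRadius s k (s j).1 := by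
  refine measurable_of_Iic fun r => ?_
  have h : (fun s : Fin n → Euc D × ℝ => knnRadius s k (s j).1) ⁻¹' Set.Iic r
      = {s | k ≤ (pointsIn s (s j).1 r).card} := by
    ext s
    exact knnRadius_le_iff s hk hkn _ r
  rw [h]
  exact measurableSet_le_card_pointsIn j r

theorem measurable_noiseAverage {k : ℕ} (hk : 1 ≤ k) (hkn : k ≤ n) (j : Fin n) :
    Measurable fun s : Fin n → Euc D × ℝ => noiseAverage s k (s j).1 := by
  classical
  have hset : ∀ i, MeasurableSet
      {s : Fin n → Euc D × ℝ | dist (s j).1 (s i).1 ≤ knnRadius s k (s j).1} := fun i =>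
    measurableSet_le (by fun_prop) (measurable_knnRadius hk hkn j)
  -- Sums over a random index set become sums of indicators over all indices, which are visibly
  -- measurable.
  have h : (fun s : Fin n → Euc D × ℝ => noiseAverage s k (s j).1) = fun s =>
      (∑ i, if dist (s j).1 (s i).1 ≤ knnRadius s k (s j).1 then (1 : ℝ) else 0)⁻¹ *
        ∑ i, if dist (s j).1 (s i).1 ≤ knnRadius s k (s j).1 then (s i).2 else 0 := by
    ext s
    simp only [noiseAverage, knnSet, pointsIn, Finset.sum_filter, Finset.sum_boole]
  rw [h]
  refine Measurable.mul (Measurable.inv ?_) ?_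
  · exact Finset.measurable_sum _ fun i _ => Measurable.ite (hset i) measurable_const measurable_const
  · exact Finset.measurable_sum _ fun i _ => Measurable.ite (hset i) (by fun_prop) measurable_const

/-- The deterministic part of the argument: on the event that all the nearest-neighbour balls
are small and all the noise averages are small, the sample maximizer is close to the peak. -/
theorem sq_norm_sub_le_of_isSampleArgmax {𝒳 : Set (Euc D)} {f : Euc D → ℝ} {x₀ : Euc D}
    {Chat Ccheck rM lam : ℝ} (hD : 1 ≤ D) (h𝒳 : IsCompact 𝒳) (hf : ContinuousOn f 𝒳)
    (h : QuadraticPeak 𝒳 f x₀ Chat Ccheck rM lam) {s : Fin n → Euc D × ℝ} {k : ℕ} (hk : 1 ≤ k)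
    (hkn : k ≤ n) {r t : ℝ} (hrM : 2 * r ≤ rM)
    (hrt : 4 * Chat * r ^ 2 + 2 * t ≤ Ccheck * rM ^ 2) (hs : ∀ i, (s i).1 ∈ 𝒳)
    (hrad : ∀ j, k ≤ (pointsIn s (s j).1 r).card) (hnear : ∃ i, dist x₀ (s i).1 ≤ r)
    (hnoise : ∀ j, |noiseAverage s k (s j).1| ≤ t) {xhat : Euc D}
    (hx : IsSampleArgmax f s k xhat) :
    ‖xhat - x₀‖ ^ 2 ≤ max (20 * Chat / Ccheck * r ^ 2) (8 * t / Ccheck) := by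
  obtain ⟨⟨j, rfl⟩, hmax⟩ := hx
  obtain ⟨i₀, hi₀⟩ := hnear
  have hcard : ∀ x, 0 < (knnSet s k x).card := fun x => hk.trans (le_card_knnSet s hk hkn x)
  have hlow : f x₀ - 4 * Chat * r ^ 2 - t ≤ knnRegression f s k (s i₀).1 := by
    rw [knnRegression_eq]
    have h1 := (abs_le.mp (hnoise i₀)).1
    have h2 : f x₀ - 4 * Chat * r ^ 2 ≤ ((knnSet s k (s i₀).1).card : ℝ)⁻¹ *
        ∑ i ∈ knnSet s k (s i₀).1, f (s i).1 := by
      refine le_card_inv_mul_sum (hcard _) fun i hi => ?_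
      have h3 := dist_le_of_mem_knnSet hk (hrad i₀) hi
      have h4 : dist x₀ (s i).1 ≤ 2 * r := by
        linarith [dist_triangle x₀ (s i₀).1 (s i).1]
      have h5 : (s i).1 ∈ Metric.closedBall x₀ rM := by
        rw [Metric.mem_closedBall, dist_comm]
        linarith
      have h6 := h.smooth _ (h.ball_subset h5)
      rw [← dist_eq_norm] at h6
      have h7 : dist x₀ (s i).1 ^ 2 ≤ (2 * r) ^ 2 := by gcongr
      have h8 := mul_le_mul_of_nonneg_left h7 h.Chat_pos.le
      linarith
    linarith
  -- An average cannot exceed all its terms. The noise enters twice, at `s i₀` and at `s j`, hence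
  -- `2 * t`.
  obtain ⟨i, hi, hfi⟩ : ∃ i ∈ knnSet s k (s j).1, f x₀ - 4 * Chat * r ^ 2 - 2 * t ≤ f (s i).1 := by
    by_contra! hcon
    have hne : (knnSet s k (s j).1).Nonempty := Finset.card_pos.mp (hcard _)
    have h1 : ∑ i ∈ knnSet s k (s j).1, f (s i).1
        < ∑ i ∈ knnSet s k (s j).1, (f x₀ - 4 * Chat * r ^ 2 - 2 * t) :=
      Finset.sum_lt_sum_of_nonempty hne hcon
    rw [Finset.sum_const, nsmul_eq_mul, ← inv_mul_lt_iff₀ (by exact_mod_cast hcard _)] at h1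
    have h2 := hmax i₀
    rw [knnRegression_eq f s k (s j).1] at h2
    have h3 := (abs_le.mp (hnoise j)).2
    linarith
  have hij := dist_le_of_mem_knnSet hk (hrad j) hi
  -- By `hrt` and `lam_le` the value at this neighbour is at least `lam`.
  have hmem : (s i).1 ∈ peakComponent 𝒳 f x₀ lam :=
    h.mem_peakComponent h𝒳 hf (hs i) (by linarith [h.lam_le hD])
  have hdec := h.decay _ hmem
  rw [← dist_eq_norm] at hdec
  have hC := h.Ccheck_pos
  have hcc : 1 ≤ Chat / Ccheck := (one_le_div hC).mpr (h.Ccheck_le_Chat hD)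
  have hy : dist x₀ (s i).1 ^ 2 ≤ 4 * (Chat / Ccheck) * r ^ 2 + 2 * (t / Ccheck) := by
    have : Ccheck * dist x₀ (s i).1 ^ 2 ≤ 4 * Chat * r ^ 2 + 2 * t := by linarith
    rw [mul_comm, ← le_div_iff₀ hC] at this
    calc _ ≤ _ := this
      _ = _ := by ring
  have htri : ‖(s j).1 - x₀‖ ≤ r + dist x₀ (s i).1 := by
    rw [← dist_eq_norm]
    linarith [dist_triangle (s j).1 (s i).1 x₀, dist_comm (s i).1 x₀]
  have hsq : ‖(s j).1 - x₀‖ ^ 2 ≤ (r + dist x₀ (s i).1) ^ 2 := by gcongr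
  have hr2 : r ^ 2 ≤ Chat / Ccheck * r ^ 2 := le_mul_of_one_le_left (sq_nonneg r) hcc
  -- From `(r + d)² ≤ 2r² + 2d²`, with `r²` absorbed since `Chat / Ccheck ≥ 1`. Bounding the sum of
  -- two terms by twice the larger then yields 20 and 8.
  have hsum : ‖(s j).1 - x₀‖ ^ 2 ≤ 10 * (Chat / Ccheck) * r ^ 2 + 4 * (t / Ccheck) := by
    nlinarith [sq_nonneg (r - dist x₀ (s i).1)]
  have e1 : 20 * Chat / Ccheck * r ^ 2 = 20 * (Chat / Ccheck * r ^ 2) := by ring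
  have e2 : 8 * t / Ccheck = 8 * (t / Ccheck) := by ring
  rw [e1, e2]
  rcases le_total (20 * (Chat / Ccheck * r ^ 2)) (8 * (t / Ccheck)) with hle | hle
  · rw [max_eq_right hle]
    linarith
  · rw [max_eq_left hle]
    linarith

end NearestNeighbours

/-! ### Mass of balls under the design law -/

section Design

variable {D n : ℕ} {𝒳 : Set (Euc D)} {p : Euc D → ℝ}

/-- The law of a design point. -/
noncomputable def designLaw (p : Euc D → ℝ) : Measure (Euc D) :=
  volume.withDensity fun x => ENNReal.ofReal (p x)

theorem IsDensityOn.isProbabilityMeasure (hp : IsDensityOn p 𝒳) :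
    IsProbabilityMeasure (designLaw p) :=
  ⟨by rw [designLaw, withDensity_apply _ MeasurableSet.univ, setLIntegral_univ, hp.total]⟩

theorem IsDensityOn.ae_mem (hp : IsDensityOn p 𝒳) (h𝒳 : MeasurableSet 𝒳) :
    ∀ᵐ x ∂designLaw p, x ∈ 𝒳 := by
  rw [ae_iff]
  change designLaw p 𝒳ᶜ = 0
  rw [designLaw, withDensity_apply _ h𝒳.compl]
  exact (setLIntegral_congr_fun h𝒳.compl fun x hx => by simp [hp.eq_zero x hx]).trans
    lintegral_zero

theorem IsDensityOn.densityInf_le (hp : IsDensityOn p 𝒳) {x : Euc D} (hx : x ∈ 𝒳) :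
    densityInf p 𝒳 ≤ p x :=
  csInf_le ⟨0, by rintro _ ⟨y, _, rfl⟩; exact hp.nonneg y⟩ ⟨x, hx, rfl⟩

theorem unitBallVolume_pos (D : ℕ) : 0 < unitBallVolume D :=
  ENNReal.toReal_pos (Metric.measure_closedBall_pos volume 0 one_pos).ne'
    measure_closedBall_lt_top.ne

/-- Lower bound for the mass of a ball centred in the support. -/
theorem IsDensityOn.le_designLaw_closedBall (hp : IsDensityOn p 𝒳) (h𝒳 : MeasurableSet 𝒳)
    {γ r₀ : ℝ} (hreg : SupportRegular 𝒳 γ r₀) (hinf : 0 ≤ densityInf p 𝒳) {x : Euc D}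
    (hx : x ∈ 𝒳) {r : ℝ} (hr : 0 < r) (hrr : r ≤ r₀) :
    γ * densityInf p 𝒳 * unitBallVolume D * r ^ D
      ≤ (designLaw p).real (Metric.closedBall x r) := by
  have := hp.isProbabilityMeasure
  -- Regularity is assumed only for radii strictly below `r₀`; the case `r = r₀` comes from letting
  -- `r'` increase to `r`.
  have key : ∀ r' ∈ Set.Ioo 0 r, γ * densityInf p 𝒳 * unitBallVolume D * r' ^ D
      ≤ (designLaw p).real (Metric.closedBall x r) := by
    intro r' hr'
    have hms : MeasurableSet (𝒳 ∩ Metric.closedBall x r') :=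
      h𝒳.inter Metric.isClosed_closedBall.measurableSet
    have hfin : volume (𝒳 ∩ Metric.closedBall x r') ≠ ∞ :=
      ((measure_mono Set.inter_subset_right).trans_lt measure_closedBall_lt_top).ne
    have h1 := hreg x hx r' hr'.1 (hr'.2.trans_le hrr)
    rw [Measure.addHaar_real_closedBall' volume x hr'.1.le, finrank_euclideanSpace_fin] at h1
    have h2 : ENNReal.ofReal (densityInf p 𝒳) * volume (𝒳 ∩ Metric.closedBall x r')
        ≤ designLaw p (Metric.closedBall x r) := by
      calc ENNReal.ofReal (densityInf p 𝒳) * volume (𝒳 ∩ Metric.closedBall x r')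
          = ∫⁻ _ in 𝒳 ∩ Metric.closedBall x r', ENNReal.ofReal (densityInf p 𝒳) := by
            rw [setLIntegral_const]
        _ ≤ ∫⁻ y in 𝒳 ∩ Metric.closedBall x r', ENNReal.ofReal (p y) :=
            setLIntegral_mono' hms fun y hy => ENNReal.ofReal_le_ofReal (hp.densityInf_le hy.1)
        _ = designLaw p (𝒳 ∩ Metric.closedBall x r') := by
            rw [designLaw, withDensity_apply _ hms]
        _ ≤ _ := measure_mono (Set.inter_subset_right.trans
            (Metric.closedBall_subset_closedBall hr'.2.le))
    have h3 := ENNReal.toReal_mono (measure_ne_top _ _) h2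
    rw [ENNReal.toReal_mul, ENNReal.toReal_ofReal hinf] at h3
    calc γ * densityInf p 𝒳 * unitBallVolume D * r' ^ D
        = densityInf p 𝒳 * (γ * (r' ^ D * unitBallVolume D)) := by ring
      _ ≤ densityInf p 𝒳 * (volume : Measure (Euc D)).real (𝒳 ∩ Metric.closedBall x r') := by
          gcongr
          exact h1
      _ ≤ _ := h3
  have hlim : Tendsto (fun r' : ℝ => γ * densityInf p 𝒳 * unitBallVolume D * r' ^ D) (𝓝[<] r)
      (𝓝 (γ * densityInf p 𝒳 * unitBallVolume D * r ^ D)) :=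
    (Continuous.tendsto (by fun_prop) r).mono_left nhdsWithin_le_nhds
  refine le_of_tendsto hlim ?_
  filter_upwards [Ioo_mem_nhdsLT hr] with r' hr'
  exact key r' hr'

end Design

/-! ### Chernoff bound for counts -/

section Counting

variable {Ω : Type*} [MeasurableSpace Ω]

open Classical in
/-- A Chernoff bound for the number of sample points in a set. -/
theorem measure_card_lt_le (P : Measure Ω) [IsProbabilityMeasure P] {A : Set Ω}
    (hA : MeasurableSet A) {q : ℝ} (hq : q ≤ P.real A) (m k : ℕ) :
    (Measure.pi fun _ : Fin m => P) {u | (Finset.univ.filter fun i => u i ∈ A).card < k}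
      ≤ ENNReal.ofReal (2 ^ k * Real.exp (-(m * q) / 2)) := by
  -- The product of `g` over the sample is `2^(-count)`; Markov's inequality is applied to it.
  set g : Ω → ℝ := fun ω => 1 - A.indicator (fun _ => (1 / 2 : ℝ)) ω with hg
  have hgv : ∀ ω, g ω = if ω ∈ A then 1 / 2 else 1 := fun ω => by
    by_cases h : ω ∈ A
    · simp only [hg, Set.indicator_of_mem h, if_pos h]
      norm_num
    · simp only [hg, Set.indicator_of_notMem h, if_neg h]
      norm_num
  have hint : ∫ ω, g ω ∂P = 1 - P.real A / 2 := by
    rw [integral_sub (integrable_const _) ((integrable_const _).indicator hA),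
      integral_indicator_const _ hA]
    simp
    ring
  have hgi : Integrable g P := (integrable_const _).sub ((integrable_const _).indicator hA)
  have hprod : ∀ u : Fin m → Ω,
      ∏ i, g (u i) = (1 / 2) ^ (Finset.univ.filter fun i => u i ∈ A).card := fun u => by
    simp only [hgv, Finset.prod_ite, Finset.prod_const, one_pow, mul_one]
  have hG : Integrable (fun u : Fin m → Ω => ∏ i, g (u i)) (Measure.pi fun _ => P) :=
    Integrable.fintype_prod fun _ => hgi
  have hmarkov := mul_meas_ge_le_integral_of_nonneg
    (ae_of_all _ fun u => by rw [hprod]; positivity) hG ((1 / 2 : ℝ) ^ k)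
  rw [integral_fintype_prod_eq_pow, Fintype.card_fin, hint] at hmarkov
  have hle : (1 - P.real A / 2) ^ m ≤ Real.exp (-(m * q) / 2) := by
    have h1 : 1 - P.real A / 2 ≤ Real.exp (-q / 2) := by
      linarith [Real.add_one_le_exp (-q / 2)]
    have h0 : 0 ≤ 1 - P.real A / 2 := by linarith [measureReal_le_one (μ := P) (s := A)]
    calc _ ≤ Real.exp (-q / 2) ^ m := by gcongr
      _ = _ := by
        rw [← Real.exp_nat_mul]
        congr 1
        ring
  rw [← ENNReal.ofReal_toReal (measure_ne_top (Measure.pi fun _ : Fin m => P) _)]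
  refine ENNReal.ofReal_le_ofReal ?_
  have hsub : (Measure.pi fun _ : Fin m => P).real
        {u | (Finset.univ.filter fun i => u i ∈ A).card < k}
      ≤ (Measure.pi fun _ : Fin m => P).real {u | (1 / 2 : ℝ) ^ k ≤ ∏ i, g (u i)} := by
    refine measureReal_mono fun u hu => ?_
    simp only [Set.mem_ofPred_eq] at hu ⊢
    rw [hprod]
    exact pow_le_pow_of_le_one (by norm_num) (by norm_num) hu.le
  refine hsub.trans ?_
  rw [← div_le_iff₀' (by positivity)]
  calc _ = (1 / 2 : ℝ) ^ k *
        (Measure.pi fun _ : Fin m => P).real {u | (1 / 2 : ℝ) ^ k ≤ ∏ i, g (u i)} := by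
        rw [one_div, inv_pow, div_eq_inv_mul]
    _ ≤ _ := hmarkov
    _ ≤ _ := hle

end Counting

/-! ### Tail bounds under the sample law -/

section Sample

variable {D n : ℕ} {𝒳 : Set (Euc D)} {p : Euc D → ℝ} {ν : Measure ℝ}

theorem isProbabilityMeasure_sampleLaw [IsProbabilityMeasure ν] (hp : IsDensityOn p 𝒳) (n : ℕ) :
    IsProbabilityMeasure (sampleLaw p ν n) := by
  have := hp.isProbabilityMeasure
  have : IsProbabilityMeasure ((designLaw p).prod ν) := inferInstance
  exact inferInstanceAs (IsProbabilityMeasure (Measure.pi fun _ => (designLaw p).prod ν))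

theorem ae_sampleLaw_mem [IsProbabilityMeasure ν] (hp : IsDensityOn p 𝒳) (h𝒳 : MeasurableSet 𝒳)
    (n : ℕ) : ∀ᵐ s ∂sampleLaw p ν n, ∀ i, (s i).1 ∈ 𝒳 := by
  have := hp.isProbabilityMeasure
  rw [ae_all_iff]
  intro i
  have h1 : ∀ᵐ ω ∂(designLaw p).prod ν, ω.1 ∈ 𝒳 :=
    Measure.quasiMeasurePreserving_fst.ae (hp.ae_mem h𝒳)
  exact (Measure.quasiMeasurePreserving_eval (fun _ : Fin n => (designLaw p).prod ν) i).ae h1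

/-- With exponentially small probability, fewer than `k` sample points lie in the ball of radius `r`
about a point `g` of the support that depends on one observation. -/
theorem sampleLaw_card_pointsIn_lt_le [IsProbabilityMeasure ν] (hp : IsDensityOn p 𝒳)
    (h𝒳 : MeasurableSet 𝒳) {r q : ℝ}
    (hq : ∀ x ∈ 𝒳, q ≤ (designLaw p).real (Metric.closedBall x r)) {m k : ℕ} (j : Fin (m + 1))
    {g : Euc D × ℝ → Euc D} (hg : Measurable g) (hgX : ∀ ω, ω.1 ∈ 𝒳 → g ω ∈ 𝒳) :
    sampleLaw p ν (m + 1) {s | (pointsIn s (g (s j)) r).card < k}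
      ≤ ENNReal.ofReal (2 ^ k * Real.exp (-(m * q) / 2)) := by
  classical
  have := hp.isProbabilityMeasure
  set P : Measure (Euc D × ℝ) := (designLaw p).prod ν with hP
  -- Observation `j` is split off: given it, the centre is fixed and the other `m` observations are
  -- still i.i.d.
  set T : Set ((Euc D × ℝ) × (Fin m → Euc D × ℝ)) :=
    {w | (Finset.univ.filter fun i => dist (g w.1) (w.2 i).1 ≤ r).card < k} with hT
  have hTm : MeasurableSet T := by
    have hTc : Tᶜ = ⋃ S ∈ {S : Finset (Fin m) | k ≤ S.card},
        ⋂ i ∈ S, {w : (Euc D × ℝ) × (Fin m → Euc D × ℝ) | dist (g w.1) (w.2 i).1 ≤ r} := by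
      ext w
      simp only [hT, Set.mem_compl_iff, Set.mem_ofPred_eq, not_lt, Set.mem_iUnion, Set.mem_iInter,
        exists_prop]
      constructor
      · exact fun hr => ⟨_, hr, fun i hi => (Finset.mem_filter.mp hi).2⟩
      · rintro ⟨S, hS, hSr⟩
        exact hS.trans (Finset.card_le_card fun i hi =>
          Finset.mem_filter.mpr ⟨Finset.mem_univ i, hSr i hi⟩)
    rw [← MeasurableSet.compl_iff, hTc]
    refine (Set.toFinite _).measurableSet_biUnion fun S _ =>
      S.measurableSet_biInter fun i _ => measurableSet_le ?_ measurable_const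
    fun_prop
  have hpres := measurePreserving_piFinSuccAbove (fun _ : Fin (m + 1) => P) j
  have hsub : {s : Fin (m + 1) → Euc D × ℝ | (pointsIn s (g (s j)) r).card < k}
      ⊆ MeasurableEquiv.piFinSuccAbove (fun _ => Euc D × ℝ) j ⁻¹' T := by
    -- Discarding observation `j` can only lower the count.
    intro s hs
    change (Finset.univ.filter fun i : Fin m =>
      dist (g (s j)) (s (j.succAbove i)).1 ≤ r).card < k
    refine lt_of_le_of_lt ?_ (show (pointsIn s (g (s j)) r).card < k from hs)
    have hcard := Finset.card_map (s := Finset.univ.filter fun i : Fin m =>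
      dist (g (s j)) (s (j.succAbove i)).1 ≤ r) j.succAboveEmb
    refine hcard.symm.le.trans (Finset.card_le_card fun i hi => ?_)
    obtain ⟨i', hi', rfl⟩ := Finset.mem_map.mp hi
    exact mem_pointsIn.mpr (Finset.mem_filter.mp hi').2
  calc sampleLaw p ν (m + 1) {s | (pointsIn s (g (s j)) r).card < k}
      ≤ (Measure.pi fun _ : Fin (m + 1) => P)
          (MeasurableEquiv.piFinSuccAbove (fun _ => Euc D × ℝ) j ⁻¹' T) := measure_mono hsub
    _ = (P.prod (Measure.pi fun _ : Fin m => P)) T := hpres.measure_preimage hTm.nullMeasurableSet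
    _ = ∫⁻ ω, (Measure.pi fun _ : Fin m => P) (Prod.mk ω ⁻¹' T) ∂P := Measure.prod_apply hTm
    _ ≤ ∫⁻ _, ENNReal.ofReal (2 ^ k * Real.exp (-(m * q) / 2)) ∂P := by
        refine lintegral_mono_ae ?_
        have hae : ∀ᵐ ω ∂P, ω.1 ∈ 𝒳 := Measure.quasiMeasurePreserving_fst.ae (hp.ae_mem h𝒳)
        filter_upwards [hae] with ω hω
        have hA : MeasurableSet (Metric.closedBall (g ω) r ×ˢ (Set.univ : Set ℝ)) :=
          Metric.isClosed_closedBall.measurableSet.prod MeasurableSet.univ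
        have hqA : q ≤ P.real (Metric.closedBall (g ω) r ×ˢ (Set.univ : Set ℝ)) := by
          rw [hP, measureReal_prod_prod, probReal_univ, mul_one]
          exact hq _ (hgX ω hω)
        refine le_trans (measure_mono ?_) (measure_card_lt_le P hA hqA m k)
        intro u hu
        simpa [hT, dist_comm] using hu
    _ = _ := by simp

/-- Sub-Gaussian tail of the noise average over a fixed set of indices. -/
theorem measure_lt_abs_average_le [IsProbabilityMeasure ν] {σ : ℝ≥0}
    (hsub : HasSubgaussianMGF (fun z : ℝ => z) (σ ^ 2) ν) {k : ℕ} (hk : 1 ≤ k) {S : Finset (Fin n)}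
    (hS : k ≤ S.card) {a : ℝ} (ha : 0 ≤ a) :
    (Measure.pi fun _ : Fin n => ν) {ξ | σ * √(2 * a / k) < |(S.card : ℝ)⁻¹ * ∑ i ∈ S, ξ i|}
      ≤ ENNReal.ofReal (2 * Real.exp (-a)) := by
  set Q : Measure (Fin n → ℝ) := Measure.pi fun _ : Fin n => ν with hQ
  have hcoord : ∀ i ∈ S, HasSubgaussianMGF (fun ξ : Fin n → ℝ => ξ i) (σ ^ 2) Q := fun i _ => by
    have hmap : Q.map (Function.eval i) = ν := (measurePreserving_eval (fun _ => ν) i).map_eq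
    exact HasSubgaussianMGF.of_map (X := fun z : ℝ => z) (measurable_pi_apply i).aemeasurable
      (hmap.symm ▸ hsub)
  have hind : iIndepFun (fun (i : Fin n) (ξ : Fin n → ℝ) => ξ i) Q :=
    iIndepFun_pi (X := fun _ z => z) fun _ => aemeasurable_id
  have hsum := HasSubgaussianMGF.sum_of_iIndepFun hind hcoord
  have hSpos : (0 : ℝ) < S.card := by exact_mod_cast hk.trans hS
  have hkpos : (0 : ℝ) < k := by exact_mod_cast hk
  have hkS : (k : ℝ) ≤ S.card := by exact_mod_cast hS
  set t := (σ : ℝ) * √(2 * a / k) with ht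
  have ht0 : 0 ≤ t := by positivity
  -- For `σ = 0` the exponent in the tail bound is a division by zero and says nothing; the noise
  -- then vanishes almost surely.
  rcases eq_or_ne σ 0 with hσ | hσ
  · have hz : (fun ξ : Fin n → ℝ => ∑ i ∈ S, ξ i) =ᵐ[Q] 0 := by
      refine HasSubgaussianMGF.ae_eq_zero_of_hasSubgaussianMGF_zero ?_
      simpa [hσ] using hsum
    have : Q {ξ | t < |(S.card : ℝ)⁻¹ * ∑ i ∈ S, ξ i|} = 0 := by
      refine measure_mono_null ?_ (ae_iff.mp hz)
      intro ξ hξ h0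
      simp only [Set.mem_ofPred_eq] at hξ
      simp only [Pi.zero_apply] at h0
      rw [h0, mul_zero, abs_zero] at hξ
      exact absurd hξ (not_lt.mpr ht0)
    rw [this]
    exact zero_le
  · have hσ' : (0 : ℝ) < σ := by positivity
    have htail : ∀ Y : (Fin n → ℝ) → ℝ, HasSubgaussianMGF Y (∑ _i ∈ S, σ ^ 2) Q →
        Q.real {ξ | S.card * t ≤ Y ξ} ≤ Real.exp (-a) := fun Y hY => by
      refine (hY.measure_ge_le (by positivity)).trans (Real.exp_le_exp.mpr ?_)
      have hc : ((∑ _i ∈ S, σ ^ 2 : ℝ≥0) : ℝ) = S.card * (σ : ℝ) ^ 2 := by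
        simp
      have ht2 : t ^ 2 = σ ^ 2 * (2 * a / k) := by
        rw [ht, mul_pow, Real.sq_sqrt (by positivity)]
      rw [hc, mul_pow, ht2, neg_div, neg_le_neg_iff, le_div_iff₀ (by positivity)]
      have h1 : a ≤ a / k * S.card := by
        rw [div_mul_eq_mul_div, le_div_iff₀ hkpos]
        gcongr
      calc a * (2 * (S.card * (σ : ℝ) ^ 2)) = 2 * S.card * σ ^ 2 * a := by ring
        _ ≤ 2 * S.card * σ ^ 2 * (a / k * S.card) := by gcongr
        _ = _ := by ring
    have h1 := htail _ hsum
    have h2 := htail _ hsum.neg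
    rw [← ENNReal.ofReal_toReal (measure_ne_top Q _)]
    refine ENNReal.ofReal_le_ofReal ?_
    have hcover : Q.real {ξ | t < |(S.card : ℝ)⁻¹ * ∑ i ∈ S, ξ i|}
        ≤ Q.real ({ξ | S.card * t ≤ ∑ i ∈ S, ξ i} ∪
          {ξ | S.card * t ≤ (-fun ξ : Fin n → ℝ => ∑ i ∈ S, ξ i) ξ}) := by
      refine measureReal_mono fun ξ hξ => ?_
      simp only [Set.mem_ofPred_eq] at hξ
      rw [abs_mul, abs_of_pos (inv_pos.mpr hSpos), lt_inv_mul_iff₀ hSpos] at hξ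
      rcases le_total 0 (∑ i ∈ S, ξ i) with h | h
      · left
        rw [abs_of_nonneg h] at hξ
        exact hξ.le
      · right
        rw [abs_of_nonpos h] at hξ
        exact hξ.le
    refine hcover.trans ((measureReal_union_le _ _).trans ?_)
    linarith

/-- By Fubini over the design: with the design fixed, the neighbour set is a fixed index set of size
at least `k`, and the fixed-set tail bound applies. -/
theorem sampleLaw_lt_abs_noiseAverage_le [IsProbabilityMeasure ν] (hp : IsDensityOn p 𝒳) {σ : ℝ≥0}
    (hsub : HasSubgaussianMGF (fun z : ℝ => z) (σ ^ 2) ν) {k : ℕ} (hk : 1 ≤ k) (hkn : k ≤ n)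
    {a : ℝ} (ha : 0 ≤ a) (j : Fin n) :
    sampleLaw p ν n {s | σ * √(2 * a / k) < |noiseAverage s k (s j).1|}
      ≤ ENNReal.ofReal (2 * Real.exp (-a)) := by
  have := hp.isProbabilityMeasure
  set T : Set (Fin n → Euc D × ℝ) := {s | σ * √(2 * a / k) < |noiseAverage s k (s j).1|} with hT
  have hTm : MeasurableSet T :=
    measurableSet_lt measurable_const (measurable_noiseAverage hk hkn j).abs
  have hpres := (measurePreserving_arrowProdEquivProdArrow (Euc D) ℝ (Fin n)
    (fun _ => designLaw p) (fun _ => ν)).symm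
  have hTm' := hpres.measurable hTm
  calc sampleLaw p ν n T
      = ((Measure.pi fun _ : Fin n => designLaw p).prod (Measure.pi fun _ : Fin n => ν))
          ((MeasurableEquiv.arrowProdEquivProdArrow (Euc D) ℝ (Fin n)).symm ⁻¹' T) :=
        (hpres.measure_preimage hTm.nullMeasurableSet).symm
    _ = ∫⁻ x, (Measure.pi fun _ : Fin n => ν) (Prod.mk x ⁻¹'
          ((MeasurableEquiv.arrowProdEquivProdArrow (Euc D) ℝ (Fin n)).symm ⁻¹' T))
            ∂(Measure.pi fun _ : Fin n => designLaw p) := Measure.prod_apply hTm'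
    _ ≤ ∫⁻ _, ENNReal.ofReal (2 * Real.exp (-a)) ∂(Measure.pi fun _ : Fin n => designLaw p) := by
        refine lintegral_mono fun x => ?_
        refine le_trans (measure_mono ?_) (measure_lt_abs_average_le hsub hk
          (le_card_knnSet (fun i => (x i, (0 : ℝ))) hk hkn (x j)) ha)
        intro ξ hξ
        have hset : knnSet (fun i => (x i, ξ i)) k (x j)
            = knnSet (fun i => (x i, (0 : ℝ))) k (x j) := knnSet_congr (fun _ => rfl) k (x j)
        have hξ' : σ * √(2 * a / k) < |noiseAverage (fun i => (x i, ξ i)) k (x j)| := hξ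
        rw [noiseAverage, hset] at hξ'
        exact hξ'
    _ = _ := by simp

/-- `B` need not be measurable, so the event is the complement of its measurable hull. -/
theorem withProbAtLeast_of_measure_le {Ω : Type*} [MeasurableSpace Ω] {μ : Measure Ω}
    [IsProbabilityMeasure μ] {δ : ℝ} (hδ : 0 ≤ δ) {B : Set Ω} (hB : μ B ≤ ENNReal.ofReal δ)
    {S : Ω → Prop} (hS : ∀ ω ∉ B, S ω) : WithProbAtLeast μ (1 - δ) S := by
  refine ⟨(toMeasurable μ B)ᶜ, (measurableSet_toMeasurable μ B).compl, ?_, fun ω hω =>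
    hS ω fun h => hω (subset_toMeasurable μ B h)⟩
  rw [prob_compl_eq_one_sub (measurableSet_toMeasurable μ B), measure_toMeasurable,
    ENNReal.ofReal_sub _ hδ, ENNReal.ofReal_one]
  exact tsub_le_tsub_left hB 1

end Sample

/-! ### The good event and the finite-sample bound -/

section FiniteSample

variable {D : ℕ} {𝒳 : Set (Euc D)} {f p : Euc D → ℝ} {ν : Measure ℝ} {x₀ : Euc D}

theorem log_four_div_ge {δ : ℝ} (hδ0 : 0 < δ) (hδ1 : δ < 1) : 1.38 ≤ Real.log (4 / δ) := by
  have h4 : Real.log 4 ≤ Real.log (4 / δ) :=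
    Real.log_le_log (by norm_num) ((le_div_iff₀ hδ0).mpr (by nlinarith))
  have h2 : Real.log 4 = 2 * Real.log 2 := by
    rw [show (4 : ℝ) = 2 ^ 2 by norm_num, Real.log_pow]
    norm_num
  linarith [Real.log_two_gt_d9]

/-- Up to a set of small probability, all the nearest-neighbour radii at the sample points are at
most `r`, some sample point is within `r` of `x₀`, and all the noise averages are small. -/
theorem withProbAtLeast_good_event [IsProbabilityMeasure ν] (hp : IsDensityOn p 𝒳)
    (h𝒳 : MeasurableSet 𝒳) {σ : ℝ≥0} (hsub : HasSubgaussianMGF (fun z : ℝ => z) (σ ^ 2) ν)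
    (hx₀ : x₀ ∈ 𝒳) {r δ : ℝ} {n k : ℕ} (hδ0 : 0 < δ) (hδ1 : δ < 1) (hk : 1 ≤ k)
    (hkn : 2 * k ≤ n)
    (hq : ∀ x ∈ 𝒳, 2 * (k : ℝ) / n ≤ (designLaw p).real (Metric.closedBall x r))
    (hkL : 2 ^ 10 * Real.log (4 / δ) ^ 2 * Real.log n ≤ (k : ℝ)) :
    WithProbAtLeast (sampleLaw p ν n) (1 - δ) fun s =>
      (∀ i, (s i).1 ∈ 𝒳) ∧ (∀ j, k ≤ (pointsIn s (s j).1 r).card) ∧ (∃ i, dist x₀ (s i).1 ≤ r) ∧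
      ∀ j, |noiseAverage s k (s j).1| ≤ σ * √(2 * (Real.log n + Real.log (4 / δ)) / k) := by
  have hprob := isProbabilityMeasure_sampleLaw (ν := ν) hp n
  obtain ⟨m, rfl⟩ : ∃ m, n = m + 1 := ⟨n - 1, by omega⟩
  set L := Real.log (4 / δ) with hL
  set l := Real.log ((m + 1 : ℕ) : ℝ) with hl
  set q := 2 * (k : ℝ) / ((m + 1 : ℕ) : ℝ) with hqdef
  have hL1 : 1.38 ≤ L := log_four_div_ge hδ0 hδ1
  have hn2 : (2 : ℝ) ≤ ((m + 1 : ℕ) : ℝ) := by exact_mod_cast (by omega : 2 ≤ m + 1)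
  have hnpos : (0 : ℝ) < ((m + 1 : ℕ) : ℝ) := by linarith
  have hl1 : 0.69 ≤ l := by
    have := Real.log_le_log two_pos hn2
    linarith [Real.log_two_gt_d9]
  have hk2 : 2 * (k : ℝ) ≤ ((m + 1 : ℕ) : ℝ) := by exact_mod_cast hkn
  have hexpl : Real.exp l = ((m + 1 : ℕ) : ℝ) := Real.exp_log hnpos
  have hexpL : Real.exp (-L) = δ / 4 := by
    rw [Real.exp_neg, hL, Real.exp_log (by positivity), inv_div]
  set e₁ := 2 ^ k * Real.exp (-((m : ℝ) * q) / 2) with he₁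
  set e₂ := 2 * Real.exp (-(l + L)) with he₂
  have he₁0 : 0 ≤ e₁ := by positivity
  have he₂0 : 0 ≤ e₂ := by positivity
  set μ := sampleLaw p ν (m + 1) with hμ
  set t := σ * √(2 * (l + L) / k) with ht
  set B₀ : Set (Fin (m + 1) → Euc D × ℝ) := {s | ¬ ∀ i, (s i).1 ∈ 𝒳} with hB₀
  set B₁ : Fin (m + 1) → Set (Fin (m + 1) → Euc D × ℝ) :=
    fun j => {s | (pointsIn s (s j).1 r).card < k} with hB₁
  set B₂ : Set (Fin (m + 1) → Euc D × ℝ) := {s | (pointsIn s x₀ r).card < k} with hB₂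
  set B₃ : Fin (m + 1) → Set (Fin (m + 1) → Euc D × ℝ) :=
    fun j => {s | t < |noiseAverage s k (s j).1|} with hB₃
  have h0 : μ.real B₀ = 0 := by
    rw [measureReal_def, ae_iff.mp (ae_sampleLaw_mem (ν := ν) hp h𝒳 (m + 1)), ENNReal.toReal_zero]
  have h1 : ∀ j, μ.real (B₁ j) ≤ e₁ := fun j =>
    ENNReal.toReal_le_of_le_ofReal he₁0 (sampleLaw_card_pointsIn_lt_le hp h𝒳 hq j measurable_fst
      fun _ h => h)
  have h2 : μ.real B₂ ≤ e₁ :=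
    ENNReal.toReal_le_of_le_ofReal he₁0 (sampleLaw_card_pointsIn_lt_le (g := fun _ => x₀) hp h𝒳 hq 0
      measurable_const fun _ _ => hx₀)
  have h3 : ∀ j, μ.real (B₃ j) ≤ e₂ := fun j =>
    ENNReal.toReal_le_of_le_ofReal he₂0
      (sampleLaw_lt_abs_noiseAverage_le hp hsub hk (by omega) (by linarith) j)
  have h1' : μ.real (⋃ j, B₁ j) ≤ ((m + 1 : ℕ) : ℝ) * e₁ := by
    refine (measureReal_iUnion_fintype_le _).trans ((Finset.sum_le_sum fun j _ => h1 j).trans ?_)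
    simp
  have h3' : μ.real (⋃ j, B₃ j) ≤ ((m + 1 : ℕ) : ℝ) * e₂ := by
    refine (measureReal_iUnion_fintype_le _).trans ((Finset.sum_le_sum fun j _ => h3 j).trans ?_)
    simp
  have he₁le : ((m + 1 : ℕ) : ℝ) * e₁ ≤ δ / 4 := by
    -- The loss of 1 comes from the split-off observation: `(m + 1) * q = 2k` and `q ≤ 1`.
    have hmq : 2 * (k : ℝ) - 1 ≤ m * q := by
      have hq1 : q ≤ 1 := (div_le_one hnpos).mpr hk2
      have : ((m + 1 : ℕ) : ℝ) * q = 2 * k := by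
        rw [hqdef]
        field_simp
      push_cast at this
      linarith
    have h2k : (2 : ℝ) ^ k = Real.exp (k * Real.log 2) := by
      rw [Real.exp_nat_mul, Real.exp_log two_pos]
    have hkpos : (1 : ℝ) ≤ k := by exact_mod_cast hk
    have hkl : (k : ℝ) * Real.log 2 ≤ k * 0.7 := by
      gcongr
      linarith [Real.log_two_lt_d9]
    have hLl : 1.9 * l ≤ L ^ 2 * l := by
      gcongr
      nlinarith
    have hLl' : 0.95 * L ≤ L ^ 2 * l := by
      have : 0.95 ≤ L * l := by nlinarith
      nlinarith
    -- It remains to see `l + k log 2 - k + 1/2 ≤ -L`. This holds as `1 - log 2 ≥ 0.3` and `k ≥ 2^10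
    -- L² l` dominates both `l` and `L`.
    rw [he₁, h2k, ← hexpl, ← Real.exp_add, ← Real.exp_add, ← hexpL]
    refine Real.exp_le_exp.mpr ?_
    linarith
  have he₂le : ((m + 1 : ℕ) : ℝ) * e₂ ≤ δ / 2 := by
    rw [he₂, neg_add, Real.exp_add, hexpL, Real.exp_neg, hexpl]
    refine le_of_eq ?_
    field_simp
    norm_num
  have he₁le' : e₁ ≤ δ / 4 :=
    (le_mul_of_one_le_left he₁0 (by linarith)).trans he₁le
  -- The budget is `0 + δ/4 + δ/4 + δ/2`.
  refine withProbAtLeast_of_measure_le (B := ((B₀ ∪ ⋃ j, B₁ j) ∪ B₂) ∪ ⋃ j, B₃ j) hδ0.le ?_ ?_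
  · rw [ENNReal.le_ofReal_iff_toReal_le (measure_ne_top _ _) hδ0.le]
    have u1 := measureReal_union_le (μ := μ) ((B₀ ∪ ⋃ j, B₁ j) ∪ B₂) (⋃ j, B₃ j)
    have u2 := measureReal_union_le (μ := μ) (B₀ ∪ ⋃ j, B₁ j) B₂
    have u3 := measureReal_union_le (μ := μ) B₀ (⋃ j, B₁ j)
    change μ.real _ ≤ δ
    linarith
  · intro s hs
    simp only [Set.mem_union, Set.mem_iUnion, not_or, not_exists, hB₀, hB₁, hB₂, hB₃,
      Set.mem_ofPred_eq, not_not, not_lt] at hs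
    obtain ⟨⟨⟨hs0, hs1⟩, hs2⟩, hs3⟩ := hs
    obtain ⟨i, hi⟩ := Finset.card_pos.mp (lt_of_lt_of_le hk hs2)
    exact ⟨hs0, hs1, ⟨i, mem_pointsIn.mp hi⟩, hs3⟩

theorem log_add_log_le {L l : ℝ} (hL : 1.38 ≤ L) (hl : 0.69 ≤ l) : l + L ≤ 2 * (L ^ 2 * l) := by
  have hLl : 1.9 * l ≤ L ^ 2 * l := by
    gcongr
    nlinarith
  have hLl' : 0.95 * L ≤ L ^ 2 * l := by
    have : 0.95 ≤ L * l := by nlinarith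
    nlinarith
  linarith

/-- After squaring, the constants combine as `16² * 2 * 2 = 2^10`, the last factor 2 coming from
`log_add_log_le`. -/
theorem noise_level_le {L l σ k a R : ℝ} (hL : 1.38 ≤ L) (hl : 0.69 ≤ l) (hk : 0 < k)
    (ha : 0 < a) (hR : 0 < R) (h : 2 ^ 10 * L ^ 2 * l * (σ ^ 2 / (a ^ 2 * R ^ 4)) ≤ k) :
    16 * (σ * √(2 * (l + L) / k)) ≤ a * R ^ 2 := by
  refine le_of_sq_le_sq ?_ (by positivity)
  have hlL := mul_le_mul_of_nonneg_left (log_add_log_le hL hl) (sq_nonneg σ)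
  rw [← mul_div_assoc, div_le_iff₀ (by positivity)] at h
  rw [mul_pow, mul_pow, Real.sq_sqrt (div_nonneg (by linarith) hk.le), ← mul_div_assoc,
    ← mul_div_assoc, div_le_iff₀ hk]
  calc 16 ^ 2 * (σ ^ 2 * (2 * (l + L))) = 512 * (σ ^ 2 * (l + L)) := by ring
    _ ≤ 512 * (σ ^ 2 * (2 * (L ^ 2 * l))) := by gcongr
    _ = 2 ^ 10 * L ^ 2 * l * σ ^ 2 := by ring
    _ ≤ _ := h
    _ = _ := by ring

/-- The finite-sample bound for the maximizer of the `k`-NN regression function. -/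
theorem QuadraticPeak.withProbAtLeast_sq_norm_sub_le (hD : 1 ≤ D) (h𝒳 : IsCompact 𝒳)
    (hf : ContinuousOn f 𝒳) (hp : IsDensityOn p 𝒳) {γ r₀ : ℝ} (hγ : 0 < γ) (hr₀ : 0 < r₀)
    (hreg : SupportRegular 𝒳 γ r₀) (hinf : 0 < densityInf p 𝒳) [IsProbabilityMeasure ν] {σ : ℝ≥0}
    (hsub : HasSubgaussianMGF (fun z : ℝ => z) (σ ^ 2) ν) (hx₀ : x₀ ∈ 𝒳)
    {Chat Ccheck rM lam : ℝ} (h : QuadraticPeak 𝒳 f x₀ Chat Ccheck rM lam) {δ : ℝ} {n k : ℕ}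
    (hδ0 : 0 < δ) (hδ1 : δ < 1) (hk : 1 ≤ k)
    (hk_low : 2 ^ 10 * D * Real.log (4 / δ) ^ 2 * Real.log n *
      max 1 ((σ : ℝ) ^ 2 / (Ccheck ^ 2 * rM ^ 4)) ≤ (k : ℝ))
    (hk_up : (k : ℝ) ≤ 1 / 2 * γ * densityInf p 𝒳 * unitBallVolume D *
      min (r₀ ^ D) ((Ccheck * rM ^ 2 / (32 * Chat)) ^ ((D : ℝ) / 2)) * n) :
    WithProbAtLeast (sampleLaw p ν n) (1 - δ) fun s =>
      ∀ xhat : Euc D, IsSampleArgmax f s k xhat →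
        ‖xhat - x₀‖ ^ 2 ≤
          max (32 * σ / Ccheck * √((D * Real.log n + Real.log (2 / δ)) / k))
            (32 * Chat / Ccheck *
              (2 * k / (γ * densityInf p 𝒳 * unitBallVolume D * n)) ^ ((2 : ℝ) / D)) := by
  have := hp.isProbabilityMeasure
  have hCh := h.Chat_pos
  have hCc := h.Ccheck_pos
  have hrM := h.rM_pos
  have hcc := h.Ccheck_le_Chat hD
  have hDpos : (0 : ℝ) < D := by exact_mod_cast hD
  have hD1 : (1 : ℝ) ≤ D := by exact_mod_cast hD
  have hkpos : (0 : ℝ) < k := by exact_mod_cast hk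
  set c := γ * densityInf p 𝒳 * unitBallVolume D with hc
  have hcpos : 0 < c := by
    have := unitBallVolume_pos D
    positivity
  set b := Ccheck * rM ^ 2 / (32 * Chat) with hb
  have hbpos : 0 < b := by positivity
  have hn : n ≠ 0 := by
    rintro rfl
    simp only [Nat.cast_zero, mul_zero] at hk_up
    linarith
  have hnpos : (0 : ℝ) < n := by positivity
  set w := 2 * (k : ℝ) / (c * n) with hw
  have hwpos : 0 < w := by positivity
  have hwle : w ≤ min (r₀ ^ D) (b ^ ((D : ℝ) / 2)) := by
    rw [hw, div_le_iff₀ (by positivity)]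
    linarith
  -- The radius solves `c * r ^ D = 2k/n`.
  set r := w ^ ((1 : ℝ) / D) with hr
  have hrpos : 0 < r := by positivity
  have hrD : r ^ D = w := by
    rw [hr, one_div, Real.rpow_inv_natCast_pow hwpos.le (by omega)]
  have hr2 : r ^ 2 = w ^ ((2 : ℝ) / D) := by
    rw [hr, ← Real.rpow_natCast, ← Real.rpow_mul hwpos.le]
    congr 1
    push_cast
    ring
  have hrr₀ : r ≤ r₀ :=
    le_of_pow_le_pow_left₀ (by omega) hr₀.le (hrD.le.trans (hwle.trans (min_le_left _ _)))
  have hrb : r ^ 2 ≤ b := by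
    rw [hr2]
    calc w ^ ((2 : ℝ) / D) ≤ (b ^ ((D : ℝ) / 2)) ^ ((2 : ℝ) / D) := by
          gcongr
          exact hwle.trans (min_le_right _ _)
      _ = b := by
          rw [← Real.rpow_mul hbpos.le, div_mul_div_comm, mul_comm, div_self (by positivity),
            Real.rpow_one]
  have hmass : ∀ x ∈ 𝒳, 2 * (k : ℝ) / n ≤ (designLaw p).real (Metric.closedBall x r) := by
    intro x hx
    have h1 := hp.le_designLaw_closedBall h𝒳.measurableSet hreg hinf.le hx hrpos hrr₀
    rw [hrD, ← hc] at h1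
    refine le_trans (le_of_eq ?_) h1
    rw [hw]
    field_simp
  -- A mass is at most 1.
  have h2k : 2 * k ≤ n := by
    have h1 := (hmass x₀ hx₀).trans measureReal_le_one
    rw [div_le_one hnpos] at h1
    exact_mod_cast h1
  set L := Real.log (4 / δ) with hL
  set l := Real.log n with hl
  have hL1 : 1.38 ≤ L := log_four_div_ge hδ0 hδ1
  have hl1 : 0.69 ≤ l := by
    have hn2 : (2 : ℝ) ≤ n := by exact_mod_cast (by omega : 2 ≤ n)
    have := Real.log_le_log two_pos hn2
    linarith [Real.log_two_gt_d9]
  have hW : 2 ^ 10 * L ^ 2 * l ≤ 2 ^ 10 * D * L ^ 2 * l := by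
    gcongr
    linarith
  have hk1 : 2 ^ 10 * L ^ 2 * l ≤ (k : ℝ) :=
    hW.trans ((le_mul_of_one_le_right (by positivity) (le_max_left _ _)).trans hk_low)
  have hk2 : 2 ^ 10 * L ^ 2 * l * (σ ^ 2 / (Ccheck ^ 2 * rM ^ 4)) ≤ (k : ℝ) :=
    (mul_le_mul hW (le_max_right _ _) (by positivity) (by positivity)).trans hk_low
  set t := σ * √(2 * (l + L) / k) with ht
  have ht_le : 16 * t ≤ Ccheck * rM ^ 2 := noise_level_le hL1 hl1 hkpos hCc hrM hk2
  have hb' : Chat * b = Ccheck * rM ^ 2 / 32 := by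
    rw [hb]
    field_simp
  have hChr : Chat * r ^ 2 ≤ Ccheck * rM ^ 2 / 32 :=
    hb' ▸ mul_le_mul_of_nonneg_left hrb hCh.le
  have h2r : 2 * r ≤ rM := by
    refine le_of_sq_le_sq ?_ hrM.le
    have h1 : Chat * r ^ 2 ≤ Chat * (rM ^ 2 / 32) := by
      have := mul_le_mul_of_nonneg_right hcc (sq_nonneg rM)
      linarith
    have h2 := le_of_mul_le_mul_left h1 hCh
    nlinarith
  obtain ⟨E, hE, hμE, hgood⟩ :=
    withProbAtLeast_good_event hp h𝒳.measurableSet hsub hx₀ hδ0 hδ1 hk h2k hmass hk1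
  refine ⟨E, hE, hμE, fun s hs xhat hxhat => ?_⟩
  obtain ⟨g0, g1, g2, g3⟩ := hgood s hs
  refine (sq_norm_sub_le_of_isSampleArgmax hD h𝒳 hf h hk (by omega) h2r (t := t) ?_ g0 g1 g2 g3
    hxhat).trans ?_
  -- `4/32 + 2/16 = 1/4` of `Ccheck * rM²` is used.
  · linarith [mul_nonneg hCc.le (sq_nonneg rM)]
  rw [max_comm]
  refine max_le_max ?_ ?_
  · have hlog : L = Real.log 2 + Real.log (2 / δ) := by
      rw [hL, ← Real.log_mul two_ne_zero (by positivity)]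
      congr 1
      ring
    have hlog2 : Real.log 2 ≤ Real.log (2 / δ) :=
      Real.log_le_log two_pos ((le_div_iff₀ hδ0).mpr (by linarith))
    have hDl : l ≤ D * l := le_mul_of_one_le_left (by linarith) hD1
    -- This 4 times the 8 of the deterministic bound gives 32; in the other term 20 is rounded up to
    -- 32.
    have hsqrt : √(2 * (l + L) / k) ≤ 4 * √((D * l + Real.log (2 / δ)) / k) := by
      rw [show (4 : ℝ) = √(4 ^ 2) by simp, ← Real.sqrt_mul (by norm_num), ← mul_div_assoc]
      refine Real.sqrt_le_sqrt (div_le_div_of_nonneg_right ?_ hkpos.le)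
      linarith [Real.log_two_gt_d9]
    calc 8 * t / Ccheck = 8 * σ / Ccheck * √(2 * (l + L) / k) := by
          rw [ht]
          ring
      _ ≤ 8 * σ / Ccheck * (4 * √((D * l + Real.log (2 / δ)) / k)) := by gcongr
      _ = _ := by ring
  · rw [hr2]
    gcongr
    norm_num

end FiniteSample

/-! ### Asymptotic rate -/

section Rate

/-- Eventually, a number of neighbours of the order `n ^ α` with `0 < α < 1` is at least a multiple
of `log n` and at most a multiple of `n`. -/
theorem eventually_log_le_and_le_of_isTheta {k : ℕ → ℕ} {α : ℝ} (hα0 : 0 < α) (hα1 : α < 1)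
    (hk : (fun n : ℕ => (k n : ℝ)) =Θ[atTop] (fun n : ℕ => (n : ℝ) ^ α)) :
    ∃ c₁ > 0, ∃ c₂ > 0, ∀ K M : ℝ, 0 < M → ∀ᶠ n : ℕ in atTop,
      c₁ * (n : ℝ) ^ α ≤ k n ∧ (k n : ℝ) ≤ c₂ * (n : ℝ) ^ α ∧ 1 ≤ k n ∧
      K * Real.log n ≤ k n ∧ (k n : ℝ) ≤ M * n := by
  obtain ⟨c₂, hc₂, hup⟩ := hk.1.exists_pos
  obtain ⟨c₃, hc₃, hlow⟩ := hk.2.exists_pos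
  refine ⟨c₃⁻¹, inv_pos.mpr hc₃, c₂, hc₂, fun K M hM => ?_⟩
  have hcast : Tendsto (fun n : ℕ => (n : ℝ)) atTop atTop := tendsto_natCast_atTop_atTop
  -- `|K| + 1` is a positive bound for `K`, whatever its sign.
  have hlog := hcast.eventually ((isLittleO_log_rpow_atTop hα0).def
    (show 0 < c₃⁻¹ / (|K| + 1) by positivity))
  have hlin := hcast.eventually
    ((tendsto_rpow_atTop (sub_pos.mpr hα1)).eventually_ge_atTop (c₂ / M))
  filter_upwards [hup.bound, hlow.bound, hlog, hlin, eventually_ge_atTop 1] with n h1 h2 h3 h4 h5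
  have hn : (1 : ℝ) ≤ n := by exact_mod_cast h5
  have hpow : 0 < (n : ℝ) ^ α := by positivity
  have hln : 0 ≤ Real.log n := Real.log_nonneg hn
  rw [Real.norm_of_nonneg (Nat.cast_nonneg _), Real.norm_of_nonneg hpow.le] at h1 h2
  rw [Real.norm_of_nonneg hln, Real.norm_of_nonneg hpow.le] at h3
  have hlow' : c₃⁻¹ * (n : ℝ) ^ α ≤ k n := (inv_mul_le_iff₀ hc₃).mpr h2
  refine ⟨hlow', h1, ?_, ?_, ?_⟩
  · have : (0 : ℝ) < k n := lt_of_lt_of_le (by positivity) hlow'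
    exact_mod_cast this
  · refine le_trans ?_ hlow'
    calc K * Real.log n ≤ (|K| + 1) * Real.log n := by
          gcongr
          linarith [le_abs_self K]
      _ ≤ (|K| + 1) * (c₃⁻¹ / (|K| + 1) * (n : ℝ) ^ α) := by gcongr
      _ = _ := by
          field_simp
  · calc (k n : ℝ) ≤ c₂ * (n : ℝ) ^ α := h1
      _ = M * (c₂ / M * (n : ℝ) ^ α) := by field_simp
      _ ≤ M * ((n : ℝ) ^ (1 - α) * (n : ℝ) ^ α) := by gcongr
      _ = M * n := by
          rw [← Real.rpow_add (by linarith), sub_add_cancel, Real.rpow_one]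

/-- With `n ^ (4 / (4 + D))` neighbours, both terms of the finite-sample bound are of the order
`√(log n) * n ^ (-2 / (4 + D))`. -/
theorem max_error_terms_le {D : ℕ} (hD : 1 ≤ D) {a b c c₁ c₂ : ℝ} (ha : 0 ≤ a) (hb : 0 ≤ b)
    (hc : 0 < c) (hc₁ : 0 < c₁) (hc₂ : 0 < c₂) {n k L : ℝ} (hn : 1 ≤ n)
    (hk₁ : c₁ * n ^ ((4 : ℝ) / (4 + D)) ≤ k) (hk₂ : k ≤ c₂ * n ^ ((4 : ℝ) / (4 + D)))
    (hlog : 1 ≤ Real.log n) (hL : L ≤ Real.log n) :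
    max (a * √((D * Real.log n + L) / k)) (b * (2 * k / (c * n)) ^ ((2 : ℝ) / D))
      ≤ (a * √((D + 1) / c₁) + b * (2 * c₂ / c) ^ ((2 : ℝ) / D)) *
        (√(Real.log n) * n ^ (-(2 : ℝ) / (4 + D))) := by
  have hn0 : 0 < n := by linarith
  have hDpos : (0 : ℝ) < D := by exact_mod_cast hD
  have hk0 : 0 < k := lt_of_lt_of_le (by positivity) hk₁
  set l := Real.log n with hl
  have hrate : 0 < n ^ (-(2 : ℝ) / (4 + D)) := by positivity
  have hsl : 1 ≤ √l := Real.one_le_sqrt.mpr hlog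
  have h1 : √((D * l + L) / k) ≤ √((D + 1) / c₁) * (√l * n ^ (-(2 : ℝ) / (4 + D))) := by
    refine Real.sqrt_le_iff.mpr ⟨by positivity, ?_⟩
    have hsq : (n ^ (-(2 : ℝ) / (4 + D))) ^ 2 = (n ^ ((4 : ℝ) / (4 + D)))⁻¹ := by
      rw [← Real.rpow_natCast, ← Real.rpow_mul hn0.le, ← Real.rpow_neg hn0.le]
      congr 1
      push_cast
      ring
    rw [mul_pow, mul_pow, Real.sq_sqrt (by positivity), Real.sq_sqrt (by positivity), hsq]
    calc (D * l + L) / k ≤ ((D + 1) * l) / (c₁ * n ^ ((4 : ℝ) / (4 + D))) := by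
          refine div_le_div₀ (by positivity) ?_ (by positivity) hk₁
          linarith
      _ = _ := by
          rw [mul_div_mul_comm, div_eq_mul_inv l]
  have h2 : (2 * k / (c * n)) ^ ((2 : ℝ) / D)
      ≤ (2 * c₂ / c) ^ ((2 : ℝ) / D) * (√l * n ^ (-(2 : ℝ) / (4 + D))) := by
    -- `4/(4+D) - 1 = -D/(4+D)`, which the power `2/D` turns into `-2/(4+D)`.
    have hratio : 2 * k / (c * n) ≤ 2 * c₂ / c * n ^ (-(D : ℝ) / (4 + D)) := by
      have hexp : n ^ ((4 : ℝ) / (4 + D)) = n ^ (-(D : ℝ) / (4 + D)) * n := by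
        rw [← Real.rpow_add_one hn0.ne']
        congr 1
        field_simp
        ring
      rw [hexp] at hk₂
      rw [div_le_iff₀ (by positivity)]
      calc 2 * k ≤ 2 * (c₂ * (n ^ (-(D : ℝ) / (4 + D)) * n)) := by gcongr
        _ = _ := by field_simp
    calc (2 * k / (c * n)) ^ ((2 : ℝ) / D)
        ≤ (2 * c₂ / c * n ^ (-(D : ℝ) / (4 + D))) ^ ((2 : ℝ) / D) := by gcongr
      _ = (2 * c₂ / c) ^ ((2 : ℝ) / D) * n ^ (-(2 : ℝ) / (4 + D)) := by
          rw [Real.mul_rpow (by positivity) (by positivity), ← Real.rpow_mul hn0.le]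
          congr 2
          field_simp
      _ ≤ _ := by
          gcongr
          exact le_mul_of_one_le_left hrate.le hsl
  rw [add_mul]
  refine max_le ?_ ?_
  · calc _ ≤ a * (√((D + 1) / c₁) * (√l * n ^ (-(2 : ℝ) / (4 + D)))) := by gcongr
      _ = a * √((D + 1) / c₁) * (√l * n ^ (-(2 : ℝ) / (4 + D))) := by ring
      _ ≤ _ := le_add_of_nonneg_right (by positivity)
  · calc _ ≤ b * ((2 * c₂ / c) ^ ((2 : ℝ) / D) * (√l * n ^ (-(2 : ℝ) / (4 + D)))) := by gcongr
      _ = b * (2 * c₂ / c) ^ ((2 : ℝ) / D) * (√l * n ^ (-(2 : ℝ) / (4 + D))) := by ring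
      _ ≤ _ := le_add_of_nonneg_left (by positivity)

theorem le_of_sq_le_sqrt_mul_rpow {D : ℕ} {x C l n : ℝ} (hC : 0 ≤ C) (hl : 0 ≤ l) (hn : 0 ≤ n)
    (h : x ^ 2 ≤ C * (√l * n ^ (-(2 : ℝ) / (4 + D)))) :
    x ≤ √C * l ^ ((1 : ℝ) / 4) * n ^ (-(1 : ℝ) / (4 + D)) := by
  refine le_of_sq_le_sq (h.trans (le_of_eq ?_)) (by positivity)
  rw [mul_pow, mul_pow, Real.sq_sqrt hC, ← Real.rpow_natCast (l ^ _), ← Real.rpow_mul hl,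
    ← Real.rpow_natCast (n ^ _), ← Real.rpow_mul hn, Real.sqrt_eq_rpow, mul_assoc]
  congr 3
  · norm_num
  · push_cast
    ring

end Rate

/-! ### The main theorem -/

theorem theorem4 {D : ℕ} (hD : 1 ≤ D)
    (𝒳 : Set (Euc D)) (h𝒳 : IsCompact 𝒳)
    (f : Euc D → ℝ) (hf : ContinuousOn f 𝒳)
    (p : Euc D → ℝ) (hp : IsDensityOn p 𝒳)
    (γ r₀ : ℝ) (hγ : 0 < γ) (hr₀ : 0 < r₀) (h_reg : SupportRegular 𝒳 γ r₀)
    (h_inf : 0 < densityInf p 𝒳)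
    (ν : Measure ℝ) [IsProbabilityMeasure ν] (σ : ℝ≥0)
    (h_mean : ∫ z, z ∂ν = 0) (h_sub : HasSubgaussianMGF (fun z : ℝ => z) (σ ^ 2) ν)
    (x₀ : Euc D) (h_max : IsNondegenerateMax 𝒳 f x₀) :
    -- the constants of quadratic smoothness and decay exist
    (∃ Chat Ccheck rM lam : ℝ, QuadraticPeak 𝒳 f x₀ Chat Ccheck rM lam) ∧
    -- the finite-sample bound
    (∀ Chat Ccheck rM lam : ℝ, QuadraticPeak 𝒳 f x₀ Chat Ccheck rM lam →
      ∀ (δ : ℝ) (n k : ℕ), 0 < δ → δ < 1 → 1 ≤ k →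
        -- this is division by `min {1, Ccheck² rM⁴ / σ²}`, written so as to allow `σ = 0`
        2 ^ 10 * D * Real.log (4 / δ) ^ 2 * Real.log n *
            max 1 ((σ : ℝ) ^ 2 / (Ccheck ^ 2 * rM ^ 4)) ≤ (k : ℝ) →
        (k : ℝ) ≤ 1 / 2 * γ * densityInf p 𝒳 * unitBallVolume D *
            min (r₀ ^ D) ((Ccheck * rM ^ 2 / (32 * Chat)) ^ ((D : ℝ) / 2)) * n →
        WithProbAtLeast (sampleLaw p ν n) (1 - δ) fun s =>
          ∀ xhat : Euc D, IsSampleArgmax f s k xhat →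
            ‖xhat - x₀‖ ^ 2 ≤
              max (32 * σ / Ccheck * √((D * Real.log n + Real.log (2 / δ)) / k))
                (32 * Chat / Ccheck *
                  (2 * k / (γ * densityInf p 𝒳 * unitBallVolume D * n)) ^ ((2 : ℝ) / D))) ∧
    -- the rate for `k` of the order `n ^ (4 / (4 + D))`
    (∀ k : ℕ → ℕ,
      (fun n : ℕ => (k n : ℝ)) =Θ[atTop] (fun n : ℕ => (n : ℝ) ^ ((4 : ℝ) / (4 + D))) →
      ∃ C : ℝ, 0 < C ∧ ∀ δ : ℝ, 0 < δ → δ < 1 → ∃ N : ℕ, ∀ n : ℕ, N ≤ n →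
        WithProbAtLeast (sampleLaw p ν n) (1 - δ) fun s =>
          ∀ xhat : Euc D, IsSampleArgmax f s (k n) xhat →
            ‖xhat - x₀‖ ≤
              C * Real.log n ^ ((1 : ℝ) / 4) * (n : ℝ) ^ (-(1 : ℝ) / (4 + D))) := by
  have hx₀ : x₀ ∈ 𝒳 := interior_subset h_max.mem_interior
  have hpeak := h_max.exists_quadraticPeak h𝒳 hf
  refine ⟨hpeak, fun Chat Ccheck rM lam h δ n k hδ0 hδ1 hk hlow hup =>
    h.withProbAtLeast_sq_norm_sub_le hD h𝒳 hf hp hγ hr₀ h_reg h_inf h_sub hx₀ hδ0 hδ1 hk hlow hup,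
    fun k hk => ?_⟩
  obtain ⟨Chat, Ccheck, rM, lam, h⟩ := hpeak
  have hCh := h.Chat_pos
  have hCc := h.Ccheck_pos
  have hrM := h.rM_pos
  have hv := unitBallVolume_pos D
  have hDpos : (0 : ℝ) < D := by exact_mod_cast hD
  obtain ⟨c₁, hc₁, c₂, hc₂, hev⟩ := eventually_log_le_and_le_of_isTheta (by positivity)
    ((div_lt_one (by positivity)).mpr (by linarith)) hk
  set C := 32 * σ / Ccheck * √((D + 1) / c₁) +
    32 * Chat / Ccheck * (2 * c₂ / (γ * densityInf p 𝒳 * unitBallVolume D)) ^ ((2 : ℝ) / D)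
    with hC
  have hCpos : 0 < C := by positivity
  refine ⟨√C, Real.sqrt_pos.mpr hCpos, fun δ hδ0 hδ1 => ?_⟩
  have hlog : Tendsto (fun n : ℕ => Real.log n) atTop atTop :=
    Real.tendsto_log_atTop.comp tendsto_natCast_atTop_atTop
  -- Only `N` depends on `δ`: once `log (2/δ) ≤ log n`, the confidence term is absorbed and `C` is
  -- free of `δ`.
  obtain ⟨N, hN⟩ := eventually_atTop.mp
    (((hev (2 ^ 10 * D * Real.log (4 / δ) ^ 2 * max 1 ((σ : ℝ) ^ 2 / (Ccheck ^ 2 * rM ^ 4)))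
      (1 / 2 * γ * densityInf p 𝒳 * unitBallVolume D *
        min (r₀ ^ D) ((Ccheck * rM ^ 2 / (32 * Chat)) ^ ((D : ℝ) / 2))) (by positivity)).and
      (hlog.eventually_ge_atTop (max 1 (Real.log (2 / δ))))).and (eventually_ge_atTop 1))
  refine ⟨N, fun n hn => ?_⟩
  obtain ⟨⟨⟨h1, h2, h3, h4, h5⟩, h6⟩, h7⟩ := hN n hn
  have hn1 : (1 : ℝ) ≤ n := by exact_mod_cast h7
  obtain ⟨E, hE, hμE, hbound⟩ := h.withProbAtLeast_sq_norm_sub_le hD h𝒳 hf hp hγ hr₀ h_reg h_inf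
    h_sub hx₀ hδ0 hδ1 h3 (le_trans (le_of_eq (by ring)) h4) h5
  refine ⟨E, hE, hμE, fun s hs xhat hxhat => ?_⟩
  refine le_of_sq_le_sqrt_mul_rpow hCpos.le (Real.log_nonneg hn1) (by linarith)
    ((hbound s hs xhat hxhat).trans ?_)
  exact max_error_terms_le hD (by positivity) (by positivity) (by positivity) hc₁ hc₂ hn1 h1 h2
    ((le_max_left _ _).trans h6) ((le_max_right _ _).trans h6)
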